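/- Fix $m\ge 1$ and let $(\mathcal U,\delta_1,\dots,\delta_m)$ be a saturated existentially closed field of characteristic zero with $m$ (possibly noncommuting) derivations. Let $\mathcal C_{\mathcal U}=\bigcap_i\ker\delta_i$, and call a differential subfield $K$ small if $|K|<|\mathcal U|$; for a subfield $F$ put $\mathcal C_F=F\cap\mathcal C_{\mathcal U}$. *Definitions.* For a Zariski closed $V\subseteq\mathcal U^n$ defined over a differential subfield $K$, let $I(V/K)\subseteq K[\bar x]$ be the ideal of polynomials vanishing on $V$, and let $\tau_{\delta}V\subseteq\mathcal U^{2n}$ be given by $f(\bar x)=0$, $\sum_j\frac{\partial f}{\partial x_j}(\bar x)\,y_j+f^{\delta}(\bar x)=0$ for $f\in I(V/K)$, where $f^\delta$ is $f$ with $\delta$ applied to its coefficients. Let $\tau_{\mathcal D}V$ be the fibred product over $V$ of $\tau_{\delta_1}V,\dots,\tau_{\delta_m}V$. An affine $D$-variety over $K$ is a pair $(V,s)$ with $s=(\mathrm{Id},s_1,\dots,s_m):V\to\tau_{\mathcal D}V$ a regular section over $K$; its $D$-points are the $a\in V$ with $s_i(a)=\delta_i(a)$ for all $i$. A $D$-subvariety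 is a Zariski closed $W\subseteq V$ with $s(W)\subseteq\tau_{\mathcal D}W$, equipped with $s|_W$. A $D$-morphism is a regular map taking $D$-points to $D$-points. A $D$-variety is $K$-irreducible if $I(V/K)$ is prime, and $a\in V$ is $K$-generic if every polynomial over $K$ that vanishes at $a$ vanishes on $V$. A $K$-irreducible $D$-variety $(V,s)$ is *isotrivial* if there are a differential field $K\subseteq F\subseteq\mathcal U$ and an injective $D$-morphism over $F$ from $(V,s)$ to some $(W,s_0)$ with $W$ defined over $\mathcal C_F$ and $s_0$ the zero section. It is *compound isotrivial in $\ell$ steps* if there are $K$-irreducible $D$-varieties $V_\ell=V,V_{\ell-1},\dots,V_1$, $V_0=0$ (a point), and dominant $D$-morphisms $f_{i+1}:V_{i+1}\to V_i$ over $K$ ($0\le i<\ell$), such that for every $K$-generic $D$-point $a$ of $V_i$ the fibre $f_{i+1}^{-1}(a)$ is an isotrivial $D$-subvariety of $V_{i+1}$ over $K(a)$. An affine algebraic $D$-group over $K$ is an affine algebraic group $G$ over $K$ with a $D$-variety structure $s:G\to\tau_{\mathcal D}G$ over $K$ that is a group homomorphism for the canonical group structure on $\tau_{\mathcal D}G$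 (the prolongation of that of $G$). *Proposition.* Let $k\subseteq\mathcal C_{\mathcal U}$ be a small field of constants and let $(G,s)$ be a connected commutative affine algebraic $D$-group over $k$. Then every $k$-irreducible $D$-subvariety of $G$ over $k$, with the restricted section, is compound isotrivial in $2$ steps (over $k$). -/

import Mathlib

open MvPolynomial Cardinal

universe u

namespace DGeom

/-! ### Differential fields with `m` (not necessarily commuting) derivations -/

section DifferentialFields

variable {U : Type u} [Field U] {m : ℕ}

/-- `K` is a differential subfield of `(U, δ₁, …, δₘ)`. -/
def IsDiffSubfield (δ : Fin m → Derivation ℤ U U) (K : Subfield U) : Prop :=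
  ∀ i, ∀ x ∈ K, δ i x ∈ K

/-- The field of constants `⋂ᵢ ker δᵢ`. -/
def constants (δ : Fin m → Derivation ℤ U U) : Subfield U where
  carrier := {x | ∀ i, δ i x = 0}
  mul_mem' := fun {a b} ha hb i => by
    have h1 := ha i
    have h2 := hb i
    simp [Derivation.leibniz, h1, h2]
  one_mem' := fun i => by simp
  add_mem' := fun {a b} ha hb i => by
    have h1 := ha i
    have h2 := hb i
    simp [h1, h2]
  zero_mem' := fun i => by simp
  neg_mem' := fun {a} ha i => by
    have h1 := ha i
    simp [h1]
  inv_mem' := fun a ha i => by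
    have h1 := ha i
    simp [Derivation.leibniz_inv, h1]

/-- The subfield `K(a)` of `U` generated by `K` and the coordinates of `a`. -/
def adjoin (K : Subfield U) {n : ℕ} (a : Fin n → U) : Subfield U :=
  Subfield.closure ((K : Set U) ∪ Set.range a)

end DifferentialFields

/-! ### The first-order language of differential rings, and saturated models -/

/-- Function symbols of the language of rings with `m` extra unary symbols. -/
inductive DiffFunc (m : ℕ) : ℕ → Type
  | zero : DiffFunc m 0
  | one : DiffFunc m 0
  | neg : DiffFunc m 1
  | add : DiffFunc m 2
  | mul : DiffFunc m 2
  | deriv (i : Fin m) : DiffFunc m 1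

/-- The language of differential rings with `m` derivations (no relation symbols but equality). -/
def diffLang (m : ℕ) : FirstOrder.Language.{0, 0} where
  Functions := DiffFunc m
  Relations := fun _ => Empty

/-- A field with `m` derivations, as a structure in the language of differential rings. -/
@[reducible]
def diffStructure {E : Type u} [Field E] {m : ℕ} (d : Fin m → Derivation ℤ E E) :
    (diffLang m).Structure E where
  funMap := fun {_} f =>
    match f with
    | DiffFunc.zero => fun _ => 0
    | DiffFunc.one => fun _ => 1
    | DiffFunc.neg => fun x => -x 0
    | DiffFunc.add => fun x => x 0 + x 1
    | DiffFunc.mul => fun x => x 0 * x 1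
    | DiffFunc.deriv i => fun x => d i (x 0)
  RelMap := fun {_} r => nomatch r

/-- `(U, δ)` is existentially closed: every quantifier-free formula with parameters from `U`
that has a realisation in a differential field extension of `U` has a realisation in `U`. -/
def IsExistentiallyClosed {U : Type u} [Field U] {m : ℕ} (δ : Fin m → Derivation ℤ U U) : Prop :=
  ∀ (E : Type u) [Field E] (d : Fin m → Derivation ℤ E E) (ι : U →+* E),
    (∀ i x, ι (δ i x) = d i (ι x)) →
    ∀ (q : ℕ) (φ : (diffLang m).Formula (U ⊕ Fin q)), φ.IsQF →
      (∃ y : Fin q → E, @FirstOrder.Language.Formula.Realize _ E (diffStructure d) _ φ (Sum.elim ι y)) →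
      ∃ x : Fin q → U, @FirstOrder.Language.Formula.Realize _ U (diffStructure δ) _ φ (Sum.elim id x)

/-- `(U, δ)` is saturated: every set of formulas in finitely many variables over a small
differential subfield which is finitely satisfiable in `U` is satisfiable in `U`. -/
def IsSaturated {U : Type u} [Field U] {m : ℕ} (δ : Fin m → Derivation ℤ U U) : Prop :=
  ∀ K : Subfield U, IsDiffSubfield δ K → #K < #U →
    ∀ (q : ℕ) (S : Set ((diffLang m).Formula (K ⊕ Fin q))),
      (∀ T : Set ((diffLang m).Formula (K ⊕ Fin q)), T ⊆ S → T.Finite →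
        ∃ x : Fin q → U, ∀ φ ∈ T,
          @FirstOrder.Language.Formula.Realize _ U (diffStructure δ) _ φ (Sum.elim Subtype.val x)) →
      ∃ x : Fin q → U, ∀ φ ∈ S,
        @FirstOrder.Language.Formula.Realize _ U (diffStructure δ) _ φ (Sum.elim Subtype.val x)

/-! ### Affine varieties in `Uⁿ` -/

section Varieties

variable {U : Type u} [Field U]

/-- `V` is Zariski closed and defined by polynomials over `k`. -/
def IsZariskiClosed (k : Type u) [Field k] [Algebra k U] {n : ℕ} (V : Set (Fin n → U)) : Prop :=
  ∃ I : Ideal (MvPolynomial (Fin n) k), V = zeroLocus U I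

/-- `V` is connected in the Zariski topology of `Uⁿ`. -/
def IsZariskiConnected {n : ℕ} (V : Set (Fin n → U)) : Prop :=
  V.Nonempty ∧ ∀ A B : Set (Fin n → U), IsZariskiClosed U A → IsZariskiClosed U B →
    V ⊆ A ∪ B → V ∩ A ∩ B = ∅ → V ⊆ A ∨ V ⊆ B

/-- `V` is `K`-irreducible: the ideal `I(V/K)` of polynomials over `K` vanishing on `V` is prime
(in particular `V` is not empty). -/
def IsIrreducibleOver (K : Subfield U) {n : ℕ} (V : Set (Fin n → U)) : Prop :=
  (vanishingIdeal K V).IsPrime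

/-- `a` is a Zariski `K`-generic point of `V`. -/
def IsGenericPoint (K : Subfield U) {n : ℕ} (V : Set (Fin n → U)) (a : Fin n → U) : Prop :=
  a ∈ V ∧ ∀ P : MvPolynomial (Fin n) K, aeval a P = 0 → P ∈ vanishingIdeal K V

/-- The polynomial map with components `P`. -/
noncomputable def polyMap {K : Subfield U} {σ : Type} {n : ℕ} (P : Fin n → MvPolynomial σ K) (x : σ → U) :
    Fin n → U :=
  fun j => aeval x (P j)

/-- `f` restricts to a regular map over `K` on the affine variety `V`. -/
def IsRegularOn (K : Subfield U) {n n' : ℕ} (V : Set (Fin n → U))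
    (f : (Fin n → U) → (Fin n' → U)) : Prop :=
  ∃ P : Fin n' → MvPolynomial (Fin n) K, ∀ x ∈ V, f x = polyMap P x

theorem IsRegularOn.mono {K L : Subfield U} (h : K ≤ L) {n n' : ℕ} {V W : Set (Fin n → U)}
    (hW : W ⊆ V) {f : (Fin n → U) → (Fin n' → U)} (hf : IsRegularOn K V f) :
    IsRegularOn L W f := by
  obtain ⟨P, hP⟩ := hf
  refine ⟨fun j => MvPolynomial.map (Subfield.inclusion h) (P j), fun x hx => ?_⟩
  rw [hP x (hW hx)]
  funext j
  simp only [polyMap, aeval_def, eval₂_map]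
  rfl

/-- The Zariski closure (in the Zariski topology of `Uⁿ`) of `f(V)` contains `W`. -/
def IsDominant {n n' : ℕ} (V : Set (Fin n → U)) (W : Set (Fin n' → U))
    (f : (Fin n → U) → (Fin n' → U)) : Prop :=
  ∀ P : MvPolynomial (Fin n') U, (∀ x ∈ V, eval (f x) P = 0) → ∀ y ∈ W, eval y P = 0

/-- The polynomial `P^d`, obtained by applying `d` to the coefficients of `P`. -/
noncomputable def coeffDeriv {K : Subfield U} {σ : Type} (d : Derivation ℤ U U)
    (P : MvPolynomial σ K) : MvPolynomial σ U :=
  ∑ e ∈ P.support, monomial e (d ((P.coeff e : K) : U))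

/-- The value `∑ⱼ (∂P/∂xⱼ)(x) · uⱼ + P^d(x)`. -/
noncomputable def prolongEval {K : Subfield U} {σ : Type} [Fintype σ] (d : Derivation ℤ U U)
    (P : MvPolynomial σ K) (x u : σ → U) : U :=
  ∑ j, aeval x (pderiv j P) * u j + eval x (coeffDeriv d P)

/-- The prolongation `τ_d V ⊆ U²ⁿ` of `V` with respect to the derivation `d`. -/
def prolongation (K : Subfield U) (d : Derivation ℤ U U) {n : ℕ} (V : Set (Fin n → U)) :
    Set ((Fin n → U) × (Fin n → U)) :=
  {p | ∀ P ∈ vanishingIdeal K V, aeval p.1 P = 0 ∧ prolongEval d P p.1 p.2 = 0}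

end Varieties

/-! ### Affine `D`-varieties -/

section DVarieties

variable {U : Type u} [Field U] {m : ℕ}

/-- An affine `D`-variety over the differential subfield `K`: a Zariski closed subset of `Uⁿ`
defined over `K` with a regular section `x ↦ (x, sec 1 x, …, sec m x)` over `K` of the fibred
product of the prolongations `τ_{δᵢ} V`. Only the values of `sec` on `carrier` matter. -/
structure DVariety (δ : Fin m → Derivation ℤ U U) (K : Subfield U) where
  n : ℕ
  carrier : Set (Fin n → U)
  isClosed : IsZariskiClosed K carrier
  sec : Fin m → (Fin n → U) → (Fin n → U)
  regular : ∀ i, IsRegularOn K carrier (sec i)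
  sec_mem : ∀ i, ∀ a ∈ carrier, (a, sec i a) ∈ prolongation K (δ i) carrier

namespace DVariety

variable {δ : Fin m → Derivation ℤ U U} {K : Subfield U}

/-- The `D`-points `(V,s)^#`. -/
def dPoints (V : DVariety δ K) : Set (Fin V.n → U) :=
  {a | a ∈ V.carrier ∧ ∀ i, V.sec i a = fun j => δ i (a j)}

/-- The section of `V` is the zero section. -/
def HasZeroSection (V : DVariety δ K) : Prop :=
  ∀ i, ∀ a ∈ V.carrier, V.sec i a = 0

/-- `Z` is a `D`-subvariety of `V`, over the field `L ⊇ K`. -/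
structure IsDSubvariety (V : DVariety δ K) (L : Subfield U) (Z : Set (Fin V.n → U)) : Prop where
  le : K ≤ L
  subset : Z ⊆ V.carrier
  isClosed : IsZariskiClosed L Z
  sec_mem : ∀ i, ∀ a ∈ Z, (a, V.sec i a) ∈ prolongation L (δ i) Z

/-- A `D`-subvariety with the restricted section, as a `D`-variety over `L`. -/
def sub (V : DVariety δ K) {L : Subfield U} (Z : Set (Fin V.n → U)) (h : V.IsDSubvariety L Z) :
    DVariety δ L where
  n := V.n
  carrier := Z
  isClosed := h.isClosed
  sec := V.sec
  regular := fun i => (V.regular i).mono h.le h.subset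
  sec_mem := h.sec_mem

/-- `f` is a `D`-morphism over `L` from `V` to `W`. -/
structure IsDMorphism {K' : Subfield U} (L : Subfield U) (V : DVariety δ K) (W : DVariety δ K')
    (f : (Fin V.n → U) → (Fin W.n → U)) : Prop where
  regular : IsRegularOn L V.carrier f
  mapsTo : Set.MapsTo f V.carrier W.carrier
  mapsTo_dPoints : Set.MapsTo f V.dPoints W.dPoints

/-- `(V,s)` is `K`-irreducible and isotrivial: there are a differential field `F ⊇ K` in `U` and an
injective `D`-morphism over `F` from `V` to some `(W, s₀)`, with `W` defined over the constants
of `F` and `s₀` the zero section. -/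
def IsIsotrivial (V : DVariety δ K) : Prop :=
  IsIrreducibleOver K V.carrier ∧
  ∃ F : Subfield U, IsDiffSubfield δ F ∧ K ≤ F ∧
    ∃ W : DVariety δ (F ⊓ constants δ), W.HasZeroSection ∧
      ∃ f : (Fin V.n → U) → (Fin W.n → U), IsDMorphism F V W f ∧ Set.InjOn f V.carrier

/-- `X` is compound isotrivial in `ℓ` steps: there is a chain of dominant `D`-morphisms over `K`
`X = V ℓ → V (ℓ - 1) → ⋯ → V 1 → V 0 = 0` of `K`-irreducible `D`-varieties over `K`, such that the
fibre of `V (i + 1) → V i` over every Zariski `K`-generic `D`-point `a` of `V i` is an isotrivial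
`D`-subvariety over `K(a)`. -/
def IsCompoundIsotrivial (X : DVariety δ K) (ℓ : ℕ) : Prop :=
  ∃ V : ℕ → DVariety δ K, V ℓ = X ∧ (V 0).carrier = {0} ∧
    (∀ i ≤ ℓ, IsIrreducibleOver K (V i).carrier) ∧
    ∀ i < ℓ, ∃ f : (Fin (V (i + 1)).n → U) → (Fin (V i).n → U),
      IsDMorphism K (V (i + 1)) (V i) f ∧
      IsDominant (V (i + 1)).carrier (V i).carrier f ∧
      ∀ a ∈ (V i).dPoints, IsGenericPoint K (V i).carrier a →
        ∃ h : (V (i + 1)).IsDSubvariety (adjoin K a) {x | x ∈ (V (i + 1)).carrier ∧ f x = a},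
          ((V (i + 1)).sub _ h).IsIsotrivial

end DVariety

/-- An affine algebraic `D`-group over `K`: an affine algebraic group over `K` (a Zariski closed
set over `K` with polynomial group operations over `K`) together with a `D`-variety structure over
`K` whose section is a group homomorphism into the prolongation, where `(a, u) * (b, v)` in the
prolongation is obtained by prolonging the multiplication polynomials. -/
structure DGroup (δ : Fin m → Derivation ℤ U U) (K : Subfield U) extends DVariety δ K where
  mulPoly : Fin n → MvPolynomial (Fin n ⊕ Fin n) K
  invPoly : Fin n → MvPolynomial (Fin n) K
  one : Fin n → K
  one_mem : (fun j => (one j : U)) ∈ carrier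
  mul_mem : ∀ a ∈ carrier, ∀ b ∈ carrier, polyMap mulPoly (Sum.elim a b) ∈ carrier
  inv_mem : ∀ a ∈ carrier, polyMap invPoly a ∈ carrier
  mul_assoc : ∀ a ∈ carrier, ∀ b ∈ carrier, ∀ c ∈ carrier,
    polyMap mulPoly (Sum.elim (polyMap mulPoly (Sum.elim a b)) c) =
      polyMap mulPoly (Sum.elim a (polyMap mulPoly (Sum.elim b c)))
  one_mul : ∀ a ∈ carrier, polyMap mulPoly (Sum.elim (fun j => (one j : U)) a) = a
  inv_mul : ∀ a ∈ carrier, polyMap mulPoly (Sum.elim (polyMap invPoly a) a) = fun j => (one j : U)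
  sec_mul : ∀ i, ∀ a ∈ carrier, ∀ b ∈ carrier,
    sec i (polyMap mulPoly (Sum.elim a b)) = fun j =>
      prolongEval (δ i) (mulPoly j) (Sum.elim a b) (Sum.elim (sec i a) (sec i b))

namespace DGroup

variable {δ : Fin m → Derivation ℤ U U} {K : Subfield U}

/-- The group is commutative. -/
def IsCommutative (G : DGroup δ K) : Prop :=
  ∀ a ∈ G.carrier, ∀ b ∈ G.carrier,
    polyMap G.mulPoly (Sum.elim a b) = polyMap G.mulPoly (Sum.elim b a)

/-- The group is connected in the Zariski topology. -/
def IsConnected (G : DGroup δ K) : Prop := IsZariskiConnected G.carrier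

end DGroup

end DVarieties

end DGeom

/-!
Let `(G, s)` be a commutative affine `D`-group over a field `k` of constants. Over constants the
prolongation of `G` is its tangent bundle, so each `sᵢ` is a homomorphic section of the tangent
bundle, and the logarithmic derivative `λᵢ : a ↦ sᵢ(a) a⁻¹` is a polynomial homomorphism from `G` to
the vector group `T₁G`. The differential of the polynomial homomorphism `λⱼ` in the direction
`sᵢ(a)` is `d₁λⱼ(λᵢ(a))`, so `s` acts on all the `λᵢ` together by matrices over `k`
(`DGroup.exists_logDerivative`). Hence `λ = (λ₁, …, λₘ)` is a `D`-morphism from `G` to an affine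
space with a linear section.

For an irreducible `D`-subvariety `Z` of `G` the tower is `Z → V₁ → 0`, where `V₁` is the Zariski
closure of `λ(Z)`.
* `V₁` is isotrivial: the inverse of a fundamental matrix of the linear system `δᵢ x = Bᵢ x` maps
  its `D`-points to constants (`DVariety.isIsotrivial_of_linear`). The fundamental matrix exists
  because the system is consistent and `U` is existentially closed; no integrability condition
  arises, as the derivations need not commute.
* A fibre of `λ` on `Z` over a generic `D`-point is isotrivial (`DGroup.isIsotrivial_fibre`): it has
  a `D`-point `x₀`, and for any `D`-point `x` of it, `x x₀⁻¹` is a `D`-point of `G` with `λ = 0`.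
  There `s` vanishes, so `x x₀⁻¹` is constant, and `x ↦ x x₀⁻¹` is an injective `D`-morphism to
  affine space with the zero section.

That the fibres over generic `D`-points are irreducible `D`-subvarieties is commutative algebra
(`isPrime_span_fibreEquations`, `DVariety.isDSubvariety_fibre`). `D`-points exist on every nonempty
`D`-variety because a minimal prime over a differential ideal is differential in characteristic zero,
so that its residue field is a differential extension of `U` (`IsExistentiallyClosed.exists_dPoint`).

Prolongations are treated through the dual numbers: `∑ⱼ (∂P/∂xⱼ)(x) uⱼ + P^d(x)` is the
`ε`-component of the value at `x + ε u` of `P` with coefficients mapped by `c ↦ c + ε d c` (`jet`).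
The group law on the tangent bundle is then the one of `G` over the dual numbers.
-/

namespace DGeom

/-! ### Derivations and dual numbers -/

section DualNumbers

open TrivSqZeroExt

/-- The ring homomorphism `c ↦ f c + ε f (d c)` into the dual numbers, for a derivation `d`. -/
def dualHom {R A : Type*} [CommRing R] [CommRing A] (f : R →+* A) (d : Derivation ℤ R R) :
    R →+* DualNumber A where
  toFun c := inl (f c) + inr (f (d c))
  map_one' := by ext <;> simp
  map_zero' := by ext <;> simp
  map_add' a b := by ext <;> simp
  map_mul' a b := by
    ext
    · simp
    · simp; ring

@[simp]
theorem fst_dualHom {R A : Type*} [CommRing R] [CommRing A] (f : R →+* A)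
    (d : Derivation ℤ R R) (c : R) : (dualHom f d c).fst = f c := by
  simp [dualHom]

@[simp]
theorem snd_dualHom {R A : Type*} [CommRing R] [CommRing A] (f : R →+* A)
    (d : Derivation ℤ R R) (c : R) : (dualHom f d c).snd = f (d c) := by
  simp [dualHom]

/-- The `ε`-component of a ring section of `A[ε] → A` is a derivation. -/
def derivationOfDualHom {A : Type*} [CommRing A] (φ : A →+* DualNumber A)
    (h : ∀ a, (φ a).fst = a) : Derivation ℤ A A :=
  Derivation.mk'
    { toFun := fun a => (φ a).snd
      map_add' := fun a b => by simp
      map_smul' := fun n a => by simp }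
    (fun a b => by simp [h]; ring)

@[simp]
theorem derivationOfDualHom_apply {A : Type*} [CommRing A] (φ : A →+* DualNumber A)
    (h : ∀ a, (φ a).fst = a) (a : A) : derivationOfDualHom φ h a = (φ a).snd := rfl

variable {R : Type*} [CommRing R] {σ : Type*}

/-- The ring homomorphism behind `polyDerivation`. -/
noncomputable def polyDualHom (d : Derivation ℤ R R) (s : σ → MvPolynomial σ R) :
    MvPolynomial σ R →+* DualNumber (MvPolynomial σ R) :=
  eval₂Hom (dualHom C d) (fun j => inl (X j) + inr (s j))

theorem fst_polyDualHom (d : Derivation ℤ R R) (s : σ → MvPolynomial σ R)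
    (P : MvPolynomial σ R) : (polyDualHom d s P).fst = P := by
  have : ((fstHom R (MvPolynomial σ R) (MvPolynomial σ R)).toRingHom.comp
      (polyDualHom d s)) = RingHom.id _ := by
    ext <;> simp [polyDualHom]
  exact congrArg (fun f => f P) this

/-- The derivation of `R[x]` that extends the derivation `d` of `R` and sends `xⱼ` to `sⱼ`. -/
noncomputable def polyDerivation (d : Derivation ℤ R R) (s : σ → MvPolynomial σ R) :=
  derivationOfDualHom (polyDualHom d s) (fst_polyDualHom d s)

@[simp]
theorem polyDerivation_C (d : Derivation ℤ R R) (s : σ → MvPolynomial σ R) (c : R) :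
    polyDerivation d s (C c) = C (d c) := by
  simp [polyDerivation, polyDualHom]

@[simp]
theorem polyDerivation_X (d : Derivation ℤ R R) (s : σ → MvPolynomial σ R) (j : σ) :
    polyDerivation d s (X j) = s j := by
  simp [polyDerivation, polyDualHom]

/-- Evaluation of polynomials at a point with coordinates in the dual numbers, the coefficients
`c` being sent to `c + ε d c`. -/
noncomputable def jet (d : Derivation ℤ R R) (α : σ → DualNumber R) :
    MvPolynomial σ R →+* DualNumber R :=
  eval₂Hom (dualHom (RingHom.id R) d) α

@[simp]
theorem jet_X (d : Derivation ℤ R R) (α : σ → DualNumber R) (j : σ) : jet d α (X j) = α j := by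
  simp [jet]

@[simp]
theorem jet_C (d : Derivation ℤ R R) (α : σ → DualNumber R) (c : R) :
    jet d α (C c) = dualHom (RingHom.id R) d c := by
  simp [jet]

theorem fst_jet (d : Derivation ℤ R R) (α : σ → DualNumber R) (P : MvPolynomial σ R) :
    (jet d α P).fst = eval (fun j => (α j).fst) P := by
  have : ((fstHom R R R).toRingHom.comp (jet d α)) = eval (fun j => (α j).fst) := by
    ext <;> simp
  exact congrArg (fun f => f P) this

/-- The point `x + ε u` over the dual numbers. -/
def jetPoint (x u : σ → R) : σ → DualNumber R := fun j => inl (x j) + inr (u j)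

@[simp] theorem fst_jetPoint (x u : σ → R) (j : σ) : (jetPoint x u j).fst = x j := by
  simp [jetPoint]

@[simp] theorem snd_jetPoint (x u : σ → R) (j : σ) : (jetPoint x u j).snd = u j := by
  simp [jetPoint]

theorem eval_polyDerivation (d : Derivation ℤ R R) (s : σ → MvPolynomial σ R)
    (P : MvPolynomial σ R) (x : σ → R) :
    eval x (polyDerivation d s P) = (jet d (jetPoint x fun j => eval x (s j)) P).snd := by
  induction P using MvPolynomial.induction_on with
  | C a => simp
  | add p q hp hq => simp [hp, hq]
  | mul_X p j hp =>
    rw [Derivation.leibniz, map_mul, DualNumber.snd_mul, ← hp, fst_jet]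
    simp
    ring

/-- A derivation acts on a value `P(x)` through the prolongation of `P`. -/
theorem snd_jet_derivation (d : Derivation ℤ R R) (P : MvPolynomial σ R) (x : σ → R) :
    (jet d (jetPoint x fun j => d (x j)) P).snd = d (eval x P) := by
  induction P using MvPolynomial.induction_on with
  | C a => simp
  | add p q hp hq => simp [hp, hq]
  | mul_X p j hp =>
    rw [map_mul, DualNumber.snd_mul, hp, fst_jet]
    simp
    ring

theorem jet_bind₁ {τ : Type*} (d : Derivation ℤ R R) (α : τ → DualNumber R)
    (f : σ → MvPolynomial τ R) (P : MvPolynomial σ R) :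
    jet d α (bind₁ f P) = jet d (fun j => jet d α (f j)) P := by
  induction P using MvPolynomial.induction_on with
  | C a => simp
  | add p q hp hq => simp [hp, hq]
  | mul_X p j hp => simp [hp]

end DualNumbers

/-! ### Ideals stable under a derivation -/

section DifferentialIdeals

variable {A : Type*} [CommRing A]

/-- The Leibniz rule for iterates of a derivation. -/
theorem iterate_derivation_mul (D : Derivation ℤ A A) (n : ℕ) (a b : A) :
    D^[n] (a * b) =
      ∑ ij ∈ Finset.HasAntidiagonal.antidiagonal n, (n.choose ij.1 : A) * (D^[ij.1] a * D^[ij.2] b) := by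
  induction n with
  | zero => simp
  | succ n ih =>
    rw [Finset.sum_antidiagonal_choose_succ_mul (fun i j => D^[i] a * D^[j] b) n,
      Function.iterate_succ_apply', ih, map_sum, ← Finset.sum_add_distrib]
    refine Finset.sum_congr rfl fun ij hij => ?_
    obtain ⟨i, j⟩ := ij
    simp only [Derivation.leibniz, smul_eq_mul, Function.iterate_succ_apply',
      Derivation.map_natCast]
    have : (n.choose j : A) = n.choose i := by
      have h := Finset.HasAntidiagonal.mem_antidiagonal.1 hij
      rw [Nat.choose_symm_of_eq_add (by simpa using h.symm : n = i + j)]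
    rw [this]
    ring

/-- The largest ideal stable under `D` that is contained in `P`. -/
def stableCore (D : Derivation ℤ A A) (P : Ideal A) : Ideal A where
  carrier := {a | ∀ n, D^[n] a ∈ P}
  add_mem' {a b} ha hb n := by
    rw [iterate_map_add]
    exact P.add_mem (ha n) (hb n)
  zero_mem' n := by
    rw [iterate_map_zero]
    exact P.zero_mem
  smul_mem' c a ha n := by
    rw [smul_eq_mul, iterate_derivation_mul]
    exact Ideal.sum_mem _ fun ij _ => P.mul_mem_left _ (P.mul_mem_left _ (ha _))

/-- In characteristic zero the largest `D`-stable ideal inside a prime ideal is prime: for `a`, `b`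
outside it and `p`, `q` minimal with `Dᵖ a ∉ P` and `D^q b ∉ P`, the Leibniz rule shows
`D^(p+q) (a b) ∉ P`. -/
theorem isPrime_stableCore [Algebra ℚ A] (D : Derivation ℤ A A) (P : Ideal A) [hP : P.IsPrime] :
    (stableCore D P).IsPrime := by
  classical
  refine ⟨fun h => hP.ne_top ?_, fun {a b} hab => ?_⟩
  · rw [Ideal.eq_top_iff_one] at h ⊢
    exact h 0
  · by_contra! hcon
    obtain ⟨ha, hb⟩ := hcon
    have ha' : ∃ n, D^[n] a ∉ P := by
      by_contra! h; exact ha h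
    have hb' : ∃ n, D^[n] b ∉ P := by
      by_contra! h; exact hb h
    set p := Nat.find ha' with hp
    set q := Nat.find hb' with hq
    have h1 := hab (p + q)
    rw [iterate_derivation_mul,
      ← Finset.add_sum_erase _ _ (Finset.HasAntidiagonal.mem_antidiagonal.2 rfl : (p, q) ∈ _)] at h1
    have h2 : ∑ ij ∈ (Finset.HasAntidiagonal.antidiagonal (p + q)).erase (p, q),
        ((p + q).choose ij.1 : A) * (D^[ij.1] a * D^[ij.2] b) ∈ P := by
      refine Ideal.sum_mem _ fun ij hij => P.mul_mem_left _ ?_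
      obtain ⟨hne, hmem⟩ := Finset.mem_erase.1 hij
      rw [Finset.HasAntidiagonal.mem_antidiagonal] at hmem
      rcases lt_or_ge ij.1 p with hlt | hge
      · exact P.mul_mem_right _ (not_not.1 (Nat.find_min ha' hlt))
      · have : ij.2 < q := by
          by_contra hge2
          exact hne (Prod.ext (by simp; omega) (by simp; omega))
        exact P.mul_mem_left _ (not_not.1 (Nat.find_min hb' this))
    have h3 := (Ideal.add_mem_iff_left _ h2).1 h1
    have hunit : IsUnit (((p + q).choose p : ℕ) : A) := by
      have : IsUnit (((p + q).choose p : ℕ) : ℚ) :=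
        IsUnit.mk0 _ (Nat.cast_ne_zero.2 (Nat.choose_pos (Nat.le_add_right p q)).ne')
      simpa using this.map (algebraMap ℚ A)
    rcases hP.mem_or_mem h3 with h | h
    · exact hP.ne_top (Ideal.eq_top_of_isUnit_mem _ h hunit)
    · rcases hP.mem_or_mem h with h | h
      · exact Nat.find_spec ha' h
      · exact Nat.find_spec hb' h

/-- In characteristic zero the minimal primes over a `D`-stable ideal are `D`-stable. -/
theorem derivation_mem_of_mem_minimalPrimes [Algebra ℚ A] (D : Derivation ℤ A A) {J P : Ideal A}
    (hJ : ∀ a ∈ J, D a ∈ J) (hP : P ∈ J.minimalPrimes) {a : A} (ha : a ∈ P) : D a ∈ P := by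
  have := hP.1.1
  have hle : J ≤ stableCore D P := fun b hb n => by
    refine hP.1.2 ?_
    induction n with
    | zero => exact hb
    | succ n ih => rw [Function.iterate_succ_apply']; exact hJ _ ih
  exact hP.2 ⟨isPrime_stableCore D P, hle⟩ (fun b hb => hb 0) ha 1

theorem derivation_mem_radical [Algebra ℚ A] (D : Derivation ℤ A A) {J : Ideal A}
    (hJ : ∀ a ∈ J, D a ∈ J) {a : A} (ha : a ∈ J.radical) : D a ∈ J.radical := by
  rw [← Ideal.sInf_minimalPrimes, Ideal.mem_sInf] at ha ⊢
  exact fun {P} hP => derivation_mem_of_mem_minimalPrimes D hJ hP (ha hP)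

theorem derivation_mem_span (D : Derivation ℤ A A) {S : Set A} (hS : ∀ a ∈ S, D a ∈ Ideal.span S)
    {a : A} (ha : a ∈ Ideal.span S) : D a ∈ Ideal.span S := by
  induction ha using Submodule.span_induction with
  | mem x hx => exact hS x hx
  | zero => simp
  | add x y _ _ hx hy => rw [map_add]; exact Ideal.add_mem _ hx hy
  | smul c x hx h =>
    rw [smul_eq_mul, Derivation.leibniz]
    exact Ideal.add_mem _ (Ideal.mul_mem_left _ _ h) (Ideal.mul_mem_right _ _ hx)

end DifferentialIdeals

/-! ### Solving differential equations in an existentially closed field -/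

section ExistentiallyClosed

open FirstOrder FirstOrder.Language

variable {U : Type u} [Field U] {m : ℕ}

/-- Polynomials in the variables and their derivatives are terms of the language of differential
rings, uniformly in the differential extension field in which they are evaluated. -/
theorem exists_term_realize_eq {σ : Type*} {q : ℕ} (e : σ ≃ Fin q)
    (P : MvPolynomial (σ ⊕ Fin m × σ) U) :
    ∃ t : (diffLang m).Term (U ⊕ Fin q), ∀ (E : Type u) [Field E] (d : Fin m → Derivation ℤ E E)
      (ι : U →+* E) (y : σ → E),
      @Term.realize _ E (diffStructure d) _ (Sum.elim ι (y ∘ e.symm)) t =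
        eval₂ ι (Sum.elim y fun p => d p.1 (y p.2)) P := by
  induction P using MvPolynomial.induction_on with
  | C a => exact ⟨Term.var (Sum.inl a), fun E _ d ι y => by simp⟩
  | add P Q hP hQ =>
    obtain ⟨s, hs⟩ := hP
    obtain ⟨t, ht⟩ := hQ
    refine ⟨Term.func (L := diffLang m) (DiffFunc.add : DiffFunc m 2) ![s, t],
      fun E _ d ι y => ?_⟩
    rw [eval₂_add, ← hs, ← ht]
    rfl
  | mul_X P v hP =>
    obtain ⟨s, hs⟩ := hP
    obtain ⟨t, ht⟩ : ∃ t : (diffLang m).Term (U ⊕ Fin q), ∀ (E : Type u) [Field E]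
        (d : Fin m → Derivation ℤ E E) (ι : U →+* E) (y : σ → E),
        @Term.realize _ E (diffStructure d) _ (Sum.elim ι (y ∘ e.symm)) t =
          Sum.elim y (fun p => d p.1 (y p.2)) v := by
      rcases v with j | ⟨i, j⟩
      · exact ⟨Term.var (Sum.inr (e j)), fun E _ d ι y => by simp⟩
      · refine ⟨Term.func (L := diffLang m) (DiffFunc.deriv i : DiffFunc m 1)
          ![Term.var (Sum.inr (e j))], fun E _ d ι y => ?_⟩
        change d i _ = _
        simp
    refine ⟨Term.func (L := diffLang m) (DiffFunc.mul : DiffFunc m 2) ![s, t],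
      fun E _ d ι y => ?_⟩
    rw [eval₂_mul, eval₂_X, ← hs, ← ht]
    rfl

/-- A finite system of differential polynomial equations of order one that has a solution in a
differential field extension of an existentially closed field has a solution in the field. -/
theorem IsExistentiallyClosed.exists_solution {δ : Fin m → Derivation ℤ U U}
    (hec : IsExistentiallyClosed δ) {σ : Type*} [Finite σ] {E : Type u} [Field E]
    (d : Fin m → Derivation ℤ E E) (ι : U →+* E) (hι : ∀ i x, ι (δ i x) = d i (ι x))
    (T : Set (MvPolynomial (σ ⊕ Fin m × σ) U)) (hT : T.Finite) (y : σ → E)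
    (hy : ∀ P ∈ T, eval₂ ι (Sum.elim y fun p => d p.1 (y p.2)) P = 0) :
    ∃ x : σ → U, ∀ P ∈ T, eval (Sum.elim x fun p => δ p.1 (x p.2)) P = 0 := by
  obtain ⟨q, ⟨e⟩⟩ := Finite.exists_equiv_fin σ
  obtain ⟨φ, hqf, hφ⟩ : ∃ φ : (diffLang m).Formula (U ⊕ Fin q), φ.IsQF ∧
      ∀ (E : Type u) [Field E] (d : Fin m → Derivation ℤ E E) (ι : U →+* E) (y : σ → E),
        @Formula.Realize _ E (diffStructure d) _ φ (Sum.elim ι (y ∘ e.symm)) ↔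
          ∀ P ∈ T, eval₂ ι (Sum.elim y fun p => d p.1 (y p.2)) P = 0 := by
    induction T, hT using Set.Finite.induction_on with
    | empty => exact ⟨⊤, BoundedFormula.IsQF.top, fun E _ d ι y => by
        let _ := diffStructure d
        simp⟩
    | @insert P T _ _ ih =>
      obtain ⟨φ, hqf, hφ⟩ := ih fun Q hQ => hy Q (Set.mem_insert_of_mem _ hQ)
      obtain ⟨t, ht⟩ := exists_term_realize_eq (m := m) e P
      obtain ⟨z, hz⟩ := exists_term_realize_eq (m := m) e (0 : MvPolynomial (σ ⊕ Fin m × σ) U)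
      refine ⟨t.equal z ⊓ φ, (BoundedFormula.IsAtomic.equal _ _).isQF.inf hqf,
        fun E _ d ι y => ?_⟩
      let _ := diffStructure d
      rw [Formula.realize_inf, Formula.realize_equal, ht, hz, hφ, eval₂_zero]
      simp
  obtain ⟨x, hx⟩ := hec E d ι hι q φ hqf ⟨y ∘ e.symm, (hφ E d ι y).2 hy⟩
  refine ⟨x ∘ e, (hφ U δ (RingHom.id U) (x ∘ e)).1 ?_⟩
  rwa [Function.comp_assoc, Equiv.self_comp_symm, Function.comp_id]

/-- An irreducible polynomial over an existentially closed field has a root, because derivations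
extend to finite extensions. -/
theorem IsExistentiallyClosed.exists_root_of_finiteDimensional [CharZero U]
    {δ : Fin m → Derivation ℤ U U} (hec : IsExistentiallyClosed δ) {E : Type u} [Field E]
    [Algebra U E] [FiniteDimensional U E] (p : Polynomial U) (r : E)
    (hr : Polynomial.aeval r p = 0) : ∃ x, p.eval x = 0 := by
  have hd : ∀ i, ∃ d : Derivation ℤ E E, ∀ x, algebraMap U E (δ i x) = d (algebraMap U E x) := by
    intro i
    let _ : Differential U := ⟨δ i⟩
    let _ : Differential E := Differential.differentialFiniteDimensional U E
    have _ : DifferentialAlgebra U E := Differential.differentialAlgebraFiniteDimensional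
    exact ⟨Differential.deriv, fun x => (deriv_algebraMap (A := U) (B := E) x).symm⟩
  choose d hd using hd
  obtain ⟨x, hx⟩ := hec.exists_solution (σ := Unit) d (algebraMap U E) hd
    {Polynomial.eval₂ C (X (Sum.inl ())) p} (Set.finite_singleton _) (fun _ => r) (by
      rintro P rfl
      rw [← coe_eval₂Hom, Polynomial.hom_eval₂, eval₂Hom_comp_C, eval₂Hom_X', ← hr]
      rfl)
  refine ⟨x (), ?_⟩
  have := hx _ rfl
  rw [Polynomial.hom_eval₂, eval_X] at this
  rw [← this, Polynomial.eval]
  congr 1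
  ext; simp

theorem IsExistentiallyClosed.isAlgClosed [CharZero U] {δ : Fin m → Derivation ℤ U U}
    (hec : IsExistentiallyClosed δ) : IsAlgClosed U := by
  refine IsAlgClosed.of_exists_root U fun p hmonic hirr => ?_
  have : Fact (Irreducible p) := ⟨hirr⟩
  have : FiniteDimensional U (AdjoinRoot p) := hmonic.finite_adjoinRoot
  exact hec.exists_root_of_finiteDimensional p (AdjoinRoot.root p)
    (by rw [AdjoinRoot.aeval_eq, AdjoinRoot.mk_self])

/-- A derivation of `A` that preserves the prime `P` induces one of the residue field of `P`. -/
theorem exists_derivation_residueField {A E : Type*} [CommRing A] (P : Ideal A) [P.IsPrime]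
    [Field E] [Algebra (A ⧸ P) E] [IsFractionRing (A ⧸ P) E] (D : Derivation ℤ A A)
    (hD : ∀ a ∈ P, D a ∈ P) :
    ∃ d : Derivation ℤ E E, ∀ a, d (algebraMap (A ⧸ P) E (Ideal.Quotient.mk P a)) =
      algebraMap (A ⧸ P) E (Ideal.Quotient.mk P (D a)) := by
  let π : A →+* E := (algebraMap (A ⧸ P) E).comp (Ideal.Quotient.mk P)
  have hπ : ∀ a ∈ P, π a = 0 := fun a ha => by
    rw [RingHom.comp_apply, Ideal.Quotient.eq_zero_iff_mem.2 ha, map_zero]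
  let φ₁ : A ⧸ P →+* DualNumber E := Ideal.Quotient.lift P (dualHom π D) (fun a ha => by
    ext
    · simpa using hπ a ha
    · simpa using hπ _ (hD a ha))
  have hφ₁ : ∀ a, (φ₁ a).fst = algebraMap (A ⧸ P) E a := fun a => by
    obtain ⟨Q, rfl⟩ := Ideal.Quotient.mk_surjective a
    simp [φ₁, π]
  let φ : E →+* DualNumber E := IsLocalization.lift (M := nonZeroDivisors (A ⧸ P)) (g := φ₁)
    (fun a => by
      rw [TrivSqZeroExt.isUnit_iff_isUnit_fst, hφ₁]
      exact IsLocalization.map_units E a)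
  have hφ : ∀ a, (φ a).fst = a := fun a => by
    have : (TrivSqZeroExt.fstHom E E E).toRingHom.comp φ = RingHom.id E := by
      refine IsLocalization.ringHom_ext (nonZeroDivisors (A ⧸ P)) (RingHom.ext fun a => ?_)
      simp [φ, hφ₁]
    exact congrArg (fun f => f a) this
  refine ⟨derivationOfDualHom φ hφ, fun a => ?_⟩
  simp [φ, φ₁, π]

/-- If a prime `P` of `U[x]` is stable under the derivations extending `δᵢ` by `xⱼ ↦ sᵢⱼ`, then its
zero locus has a point `x` with `δᵢ xⱼ = sᵢⱼ(x)`: the residue field `E` of `P` is a differential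
extension of `U` in which the generic point is such a zero. -/
theorem IsExistentiallyClosed.exists_dPoint_of_isPrime
    {δ : Fin m → Derivation ℤ U U} (hec : IsExistentiallyClosed δ) {σ : Type} [Finite σ]
    (s : Fin m → σ → MvPolynomial σ U) (P : Ideal (MvPolynomial σ U)) [P.IsPrime]
    {E : Type u} [Field E] [Algebra (MvPolynomial σ U ⧸ P) E]
    [IsFractionRing (MvPolynomial σ U ⧸ P) E]
    (hs : ∀ i, ∀ Q ∈ P, polyDerivation (δ i) (s i) Q ∈ P) :
    ∃ x : σ → U, (∀ Q ∈ P, eval x Q = 0) ∧ ∀ i j, δ i (x j) = eval x (s i j) := by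
  let π : MvPolynomial σ U →+* E :=
    (algebraMap (MvPolynomial σ U ⧸ P) E).comp (Ideal.Quotient.mk P)
  have hπ : ∀ Q ∈ P, π Q = 0 := fun Q hQ => by
    rw [RingHom.comp_apply, Ideal.Quotient.eq_zero_iff_mem.2 hQ, map_zero]
  have hd : ∀ i, ∃ d : Derivation ℤ E E, ∀ Q, d (π Q) = π (polyDerivation (δ i) (s i) Q) :=
    fun i => exists_derivation_residueField P _ (hs i)
  choose d hd using hd
  obtain ⟨T, hT⟩ := (isNoetherianRing_iff_ideal_fg _).1 inferInstance P
  let T₁ : Set (MvPolynomial (σ ⊕ Fin m × σ) U) := rename Sum.inl '' (T : Set _)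
  let T₂ : Set (MvPolynomial (σ ⊕ Fin m × σ) U) :=
    Set.range fun p : Fin m × σ => X (Sum.inr p) - rename Sum.inl (s p.1 p.2)
  have key : ∀ Q : MvPolynomial σ U,
      eval₂ (π.comp C) (fun j => π (X j)) Q = π Q := fun Q => by
    have : eval₂Hom (π.comp C) (fun j => π (X j)) = π := by
      ext <;> simp
    exact congrArg (fun f => f Q) this
  obtain ⟨x, hx⟩ := hec.exists_solution d (π.comp C)
    (fun i c => by
      exact ((hd i (C c)).trans (by rw [polyDerivation_C]; rfl)).symm) (T₁ ∪ T₂)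
    ((T.finite_toSet.image _).union (Set.finite_range _)) (fun j => π (X j)) (by
      rintro R (⟨Q, hQ, rfl⟩ | ⟨⟨i, j⟩, rfl⟩)
      · rw [eval₂_rename]
        refine (key Q).trans (hπ Q ?_)
        rw [← hT]
        exact Ideal.subset_span hQ
      · rw [eval₂_sub, eval₂_X, eval₂_rename, sub_eq_zero]
        refine Eq.trans ?_ (key _).symm
        rw [Sum.elim_inr, hd, polyDerivation_X])
  refine ⟨x, fun Q hQ => ?_, fun i j => ?_⟩
  · rw [← hT] at hQ
    have : Ideal.span (T : Set _) ≤ RingHom.ker (eval x) := by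
      rw [Ideal.span_le]
      intro R hR
      have := hx _ (Or.inl ⟨R, hR, rfl⟩)
      rwa [eval_rename] at this
    exact this hQ
  · have := hx _ (Or.inr ⟨(i, j), rfl⟩)
    rwa [map_sub, eval_X, eval_rename, sub_eq_zero] at this

/-- A proper ideal `J` of `U[x]` that is stable under the derivations extending `δᵢ` by
`xⱼ ↦ sᵢⱼ` has a zero `x` with `δᵢ xⱼ = sᵢⱼ(x)`. -/
theorem IsExistentiallyClosed.exists_dPoint [CharZero U] {δ : Fin m → Derivation ℤ U U}
    (hec : IsExistentiallyClosed δ) {σ : Type} [Finite σ] (s : Fin m → σ → MvPolynomial σ U)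
    (J : Ideal (MvPolynomial σ U)) (hJ : J ≠ ⊤)
    (hs : ∀ i, ∀ Q ∈ J, polyDerivation (δ i) (s i) Q ∈ J) :
    ∃ x : σ → U, (∀ Q ∈ J, eval x Q = 0) ∧ ∀ i j, δ i (x j) = eval x (s i j) := by
  obtain ⟨P, hP⟩ := Ideal.nonempty_minimalPrimes hJ
  have : P.IsPrime := hP.1.1
  obtain ⟨x, hx, hx'⟩ := hec.exists_dPoint_of_isPrime s P
    (E := FractionRing (MvPolynomial σ U ⧸ P))
    fun i Q hQ => derivation_mem_of_mem_minimalPrimes _ (hs i) hP hQ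
  exact ⟨x, fun Q hQ => hx Q (hP.1.2 hQ), hx'⟩

end ExistentiallyClosed

/-! ### Prolongations -/

section Prolongations

open TrivSqZeroExt

variable {U : Type u} [Field U] {K : Subfield U} {σ : Type}

theorem aeval_eq_eval_map (x : σ → U) (P : MvPolynomial σ K) :
    aeval x P = eval x (map (algebraMap K U) P) := by
  rw [aeval_def, eval_map]

theorem coeff_coeffDeriv (d : Derivation ℤ U U) (P : MvPolynomial σ K) (e : σ →₀ ℕ) :
    coeff e (coeffDeriv d P) = d (coeff e P : K) := by
  classical
  simp only [coeffDeriv, coeff_sum, coeff_monomial]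
  rw [Finset.sum_ite_eq' P.support e]
  split_ifs with h
  · rfl
  · rw [notMem_support_iff.1 h]
    simp

theorem coeffDeriv_C (d : Derivation ℤ U U) (c : K) :
    coeffDeriv d (C c : MvPolynomial σ K) = C (d c) := by
  classical
  ext e
  rw [coeff_coeffDeriv, coeff_C, coeff_C]
  split_ifs <;> simp

theorem coeffDeriv_add (d : Derivation ℤ U U) (P Q : MvPolynomial σ K) :
    coeffDeriv d (P + Q) = coeffDeriv d P + coeffDeriv d Q := by
  ext e
  simp [coeff_coeffDeriv]

theorem coeffDeriv_mul_X (d : Derivation ℤ U U) (P : MvPolynomial σ K) (j : σ) :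
    coeffDeriv d (P * X j) = coeffDeriv d P * X j := by
  classical
  ext e
  rw [coeff_coeffDeriv, coeff_mul_X', coeff_mul_X']
  split_ifs
  · rw [coeff_coeffDeriv]
  · simp

/-- The restriction of a derivation to a subfield that it preserves. -/
def restrictDerivation (d : Derivation ℤ U U) (K : Subfield U) (hK : ∀ x ∈ K, d x ∈ K) :=
  derivationOfDualHom (A := K)
    { toFun := fun c => inl c + inr ⟨d c, hK c c.2⟩
      map_one' := by ext <;> simp
      map_zero' := by ext <;> simp
      map_add' := fun a b => by ext <;> simp
      map_mul' := fun a b => by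
        ext
        · simp
        · simp; ring } (fun a => by simp)

theorem restrictDerivation_apply (d : Derivation ℤ U U) (K : Subfield U)
    (hK : ∀ x ∈ K, d x ∈ K) (c : K) : (restrictDerivation d K hK c : U) = d c := by
  simp [restrictDerivation]

theorem map_polyDerivation (d : Derivation ℤ U U) (hK : ∀ x ∈ K, d x ∈ K)
    (s : σ → MvPolynomial σ K) (P : MvPolynomial σ K) :
    map (algebraMap K U) (polyDerivation (restrictDerivation d K hK) s P) =
      polyDerivation d (fun j => map (algebraMap K U) (s j)) (map (algebraMap K U) P) := by
  induction P using MvPolynomial.induction_on with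
  | C a =>
    rw [polyDerivation_C, map_C, map_C, polyDerivation_C]
    exact congrArg C (restrictDerivation_apply d K hK a)
  | add p q hp hq => simp only [map_add, hp, hq]
  | mul_X p j hp =>
    simp only [Derivation.leibniz, map_mul, map_add, smul_eq_mul, polyDerivation_X, map_X, hp]

variable [Fintype σ]

/-- The value `∑ⱼ (∂P/∂xⱼ)(x) uⱼ + P^d(x)` is the `ε`-component of `P(x + ε u)`, where `ε` also
carries the derivatives of the coefficients. -/
theorem prolongEval_eq_snd_jet (d : Derivation ℤ U U) (P : MvPolynomial σ K) (x u : σ → U) :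
    prolongEval d P x u = (jet d (jetPoint x u) (map (algebraMap K U) P)).snd := by
  classical
  induction P using MvPolynomial.induction_on with
  | C a => simp [prolongEval, coeffDeriv_C]; rfl
  | add P Q hP hQ =>
    rw [map_add, map_add, snd_add, ← hP, ← hQ]
    simp only [prolongEval, coeffDeriv_add, map_add, add_mul, Finset.sum_add_distrib]
    ring
  | mul_X P j hP =>
    rw [map_mul, map_mul, DualNumber.snd_mul, ← hP, fst_jet]
    simp only [prolongEval, coeffDeriv_mul_X, map_mul, Derivation.leibniz, smul_eq_mul, pderiv_X,
      map_add, map_X, jet_X, fst_jetPoint, snd_jetPoint, aeval_X, eval_X, add_mul,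
      Finset.sum_add_distrib, aeval_eq_eval_map]
    rw [Finset.sum_eq_single j]
    · simp only [Pi.single_eq_same, map_one, mul_one]
      have : ∑ i, x j * eval x (map (algebraMap K U) (pderiv i P)) * u i =
          (∑ i, eval x (map (algebraMap K U) (pderiv i P)) * u i) * x j := by
        rw [Finset.sum_mul]
        exact Finset.sum_congr rfl fun i _ => by ring
      rw [this]
      ring
    · intro i _ hij
      rw [Pi.single_eq_of_ne hij.symm]
      simp
    · simp

theorem jet_map_eq (d : Derivation ℤ U U) (P : MvPolynomial σ K) (x u : σ → U) :
    jet d (jetPoint x u) (map (algebraMap K U) P) = inl (aeval x P) + inr (prolongEval d P x u) := by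
  ext
  · simp [fst_jet, aeval_eq_eval_map]
  · simp [prolongEval_eq_snd_jet]

theorem prolongEval_derivation (d : Derivation ℤ U U) (P : MvPolynomial σ K) (x : σ → U) :
    prolongEval d P x (fun j => d (x j)) = d (aeval x P) := by
  rw [prolongEval_eq_snd_jet, snd_jet_derivation, aeval_eq_eval_map]

/-- The chain rule for prolongations. -/
theorem prolongEval_bind₁ {τ : Type} [Fintype τ] (d : Derivation ℤ U U)
    (f : τ → MvPolynomial σ K) (P : MvPolynomial τ K) (x u : σ → U) :
    prolongEval d (bind₁ f P) x u =
      prolongEval d P (fun j => aeval x (f j)) (fun j => prolongEval d (f j) x u) := by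
  rw [prolongEval_eq_snd_jet, prolongEval_eq_snd_jet, map_bind₁, jet_bind₁]
  congr 2
  congr 1
  funext j
  rw [jet_map_eq, jetPoint]

theorem prolongEval_congr {d d' : Derivation ℤ U U} (h : ∀ c ∈ K, d c = d' c)
    (P : MvPolynomial σ K) (x u : σ → U) : prolongEval d P x u = prolongEval d' P x u := by
  have : coeffDeriv d P = coeffDeriv d' P := by
    ext e
    rw [coeff_coeffDeriv, coeff_coeffDeriv, h _ (coeff e P).2]
  simp [prolongEval, this]

theorem mem_prolongation_iff {n : ℕ} (d : Derivation ℤ U U) (V : Set (Fin n → U))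
    (x u : Fin n → U) : (x, u) ∈ prolongation K d V ↔
      ∀ P ∈ vanishingIdeal K V, jet d (jetPoint x u) (map (algebraMap K U) P) = 0 := by
  refine forall₂_congr fun P _ => ?_
  rw [jet_map_eq, TrivSqZeroExt.ext_iff]
  simp

/-- Membership in the prolongation can be checked on generators of the vanishing ideal. -/
theorem mem_prolongation_of_span {n : ℕ} {d : Derivation ℤ U U} {V : Set (Fin n → U)}
    {x u : Fin n → U} (S : Set (MvPolynomial (Fin n) K))
    (hV : vanishingIdeal K V = Ideal.span S)
    (hS : ∀ P ∈ S, aeval x P = 0 ∧ prolongEval d P x u = 0) : (x, u) ∈ prolongation K d V := by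
  rw [mem_prolongation_iff, hV]
  have : Ideal.span S ≤
      RingHom.ker ((jet d (jetPoint x u)).comp (map (algebraMap K U))) := by
    rw [Ideal.span_le]
    intro P hP
    obtain ⟨h1, h2⟩ := hS P hP
    change jet d (jetPoint x u) (map (algebraMap K U) P) = 0
    rw [jet_map_eq, h1, h2]
    simp
  exact fun P hP => this hP

/-- The extension to `U[x]` of the ideal of a variety over `K` with a section `s` of its
prolongation is stable under the derivation of `U[x]` with `xⱼ ↦ sⱼ`. -/
theorem polyDerivation_mem_map_vanishingIdeal {n : ℕ} (d : Derivation ℤ U U)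
    (hK : ∀ x ∈ K, d x ∈ K) {V : Set (Fin n → U)} (s : Fin n → MvPolynomial (Fin n) K)
    (hs : ∀ x ∈ V, (x, fun j => aeval x (s j)) ∈ prolongation K d V)
    {Q : MvPolynomial (Fin n) U} (hQ : Q ∈ (vanishingIdeal K V).map (map (algebraMap K U))) :
    polyDerivation d (fun j => map (algebraMap K U) (s j)) Q ∈
      (vanishingIdeal K V).map (map (algebraMap K U)) := by
  refine derivation_mem_span _ ?_ hQ
  rintro _ ⟨P, hP, rfl⟩
  rw [← map_polyDerivation d hK]
  refine Ideal.mem_map_of_mem _ fun x hx => ?_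
  rw [aeval_eq_eval_map, map_polyDerivation, eval_polyDerivation]
  have := ((mem_prolongation_iff d V _ _).1 (hs x hx)) P hP
  simp only [← aeval_eq_eval_map]
  rw [this, snd_zero]

theorem zeroLocus_map_vanishingIdeal {n : ℕ} {V : Set (Fin n → U)} (hV : IsZariskiClosed K V) :
    zeroLocus U ((vanishingIdeal K V).map (map (algebraMap K U))) = V := by
  obtain ⟨I, rfl⟩ := hV
  ext x
  rw [Ideal.map, zeroLocus_span]
  constructor
  · intro h P hP
    rw [aeval_eq_eval_map]
    exact h _ ⟨P, le_vanishingIdeal_zeroLocus I hP, rfl⟩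
  · rintro h _ ⟨P, hP, rfl⟩
    rw [aeval_map_algebraMap]
    exact hP x h

/-- The polynomials over `U` vanishing on a variety over `K` form the radical of the extension of
its ideal over `K`. -/
theorem vanishingIdeal_eq_radical_map [IsAlgClosed U] {n : ℕ} {V : Set (Fin n → U)}
    (hV : IsZariskiClosed K V) :
    vanishingIdeal U V = ((vanishingIdeal K V).map (map (algebraMap K U))).radical := by
  conv_lhs => rw [← zeroLocus_map_vanishingIdeal hV]
  rw [vanishingIdeal_zeroLocus_eq_radical]

/-- A section of the prolongation of `V` over `K` is also tangent to `V` over `U`: radicals of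
stable ideals are stable in characteristic zero. -/
theorem jet_eq_zero_of_mem_vanishingIdeal [CharZero U] [IsAlgClosed U] {n : ℕ}
    (d : Derivation ℤ U U) (hK : ∀ x ∈ K, d x ∈ K) {V : Set (Fin n → U)}
    (hV : IsZariskiClosed K V) (s : Fin n → MvPolynomial (Fin n) K)
    (hs : ∀ x ∈ V, (x, fun j => aeval x (s j)) ∈ prolongation K d V)
    {Q : MvPolynomial (Fin n) U} (hQ : Q ∈ vanishingIdeal U V) {x : Fin n → U} (hx : x ∈ V) :
    jet d (jetPoint x fun j => aeval x (s j)) Q = 0 := by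
  have h : polyDerivation d (fun j => map (algebraMap K U) (s j)) Q ∈ vanishingIdeal U V := by
    rw [vanishingIdeal_eq_radical_map hV] at hQ ⊢
    exact derivation_mem_radical _
      (fun Q hQ => polyDerivation_mem_map_vanishingIdeal d hK s hs hQ) hQ
  ext
  · rw [fst_jet]
    simpa using hQ x hx
  · have := h x hx
    change eval x _ = 0 at this
    rw [eval_polyDerivation] at this
    simpa [aeval_eq_eval_map] using this

end Prolongations

/-! ### Points over the dual numbers -/

section DualPoints

open TrivSqZeroExt

variable {U : Type u} [Field U] {σ τ : Type}

/-- The points of a Zariski closed set with coordinates in the dual numbers `U[ε]`, that is, the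
tangent vectors at its points. -/
def dualPoints (V : Set (σ → U)) : Set (σ → DualNumber U) :=
  {α | (fun j => (α j).fst) ∈ V ∧ ∀ Q ∈ vanishingIdeal U V, jet 0 α Q = 0}

/-- A point regarded as a point over the dual numbers. -/
def constPoint (x : σ → U) : σ → DualNumber U := fun j => inl (x j)

@[simp] theorem fst_constPoint (x : σ → U) (j : σ) : (constPoint x j).fst = x j := fst_inl _ _

@[simp] theorem snd_constPoint (x : σ → U) (j : σ) : (constPoint x j).snd = 0 := snd_inl _ _

theorem eval_bind₁_eq (x : τ → U) (f : σ → MvPolynomial τ U) (P : MvPolynomial σ U) :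
    eval x (bind₁ f P) = eval (fun j => eval x (f j)) P :=
  aeval_bind₁ x f P

theorem jet_zero_constPoint (x : σ → U) (P : MvPolynomial σ U) :
    jet 0 (constPoint x) P = inl (eval x P) := by
  induction P using MvPolynomial.induction_on with
  | C a => simp [dualHom]
  | add p q hp hq => simp [hp, hq]
  | mul_X p j hp => simp [hp, constPoint]

theorem constPoint_mem_dualPoints {V : Set (σ → U)} {x : σ → U} (hx : x ∈ V) :
    constPoint x ∈ dualPoints V := by
  refine ⟨by simpa [constPoint] using hx, fun Q hQ => ?_⟩
  have : eval x Q = 0 := hQ x hx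
  rw [jet_zero_constPoint, this, inl_zero]

theorem fst_sumElim {A : Type*} (α : σ → DualNumber A) (β : τ → DualNumber A) :
    (fun j => (Sum.elim α β j).fst) =
      Sum.elim (fun j => (α j).fst) (fun j => (β j).fst) := by
  funext j
  cases j <;> rfl

/-- The `ε`-component of `P(α, β)` is the sum of its two partial variations. -/
theorem snd_jet_sumElim (P : MvPolynomial (σ ⊕ τ) U) (α : σ → DualNumber U)
    (β : τ → DualNumber U) :
    (jet 0 (Sum.elim α β) P).snd =
      (jet 0 (Sum.elim α (constPoint fun j => (β j).fst)) P).snd +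
        (jet 0 (Sum.elim (constPoint fun j => (α j).fst) β) P).snd := by
  induction P using MvPolynomial.induction_on with
  | C a => simp
  | add p q hp hq =>
    simp only [map_add, snd_add, hp, hq]
    ring
  | mul_X p j hp =>
    simp only [map_mul, DualNumber.snd_mul, hp, fst_jet, fst_sumElim, jet_X, fst_constPoint]
    rcases j with j | j
    · simp only [Sum.elim_inl, fst_constPoint, snd_constPoint]
      ring
    · simp only [Sum.elim_inr, fst_constPoint, snd_constPoint]
      ring

theorem jet_eq_of_eqOn {V : Set (σ → U)} {P Q : MvPolynomial σ U}
    (h : ∀ x ∈ V, eval x P = eval x Q) {α : σ → DualNumber U} (hα : α ∈ dualPoints V) :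
    jet 0 α P = jet 0 α Q := by
  rw [← sub_eq_zero, ← map_sub]
  refine hα.2 _ fun x hx => ?_
  change eval x _ = 0
  rw [map_sub, h x hx, sub_self]

theorem mem_dualPoints_of_mapsTo {V : Set (σ → U)} {W : Set (τ → U)} (f : τ → MvPolynomial σ U)
    (hf : ∀ x ∈ V, (fun j => eval x (f j)) ∈ W) {α : σ → DualNumber U} (hα : α ∈ dualPoints V) :
    (fun j => jet 0 α (f j)) ∈ dualPoints W := by
  refine ⟨?_, fun Q hQ => ?_⟩
  · simp only [fst_jet]
    exact hf _ hα.1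
  · rw [← jet_bind₁]
    refine hα.2 _ fun x hx => ?_
    have := hQ _ (hf x hx)
    rwa [aeval_bind₁]

/-- The product of two sets of points in affine spaces. -/
def prodSet {A : Type*} (V : Set (σ → A)) (W : Set (τ → A)) : Set (σ ⊕ τ → A) :=
  {z | z ∘ Sum.inl ∈ V ∧ z ∘ Sum.inr ∈ W}

theorem sumElim_mem_prodSet {A : Type*} {V : Set (σ → A)} {W : Set (τ → A)} {x : σ → A}
    {y : τ → A} (hx : x ∈ V) (hy : y ∈ W) : Sum.elim x y ∈ prodSet V W := ⟨hx, hy⟩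

theorem forall_prodSet {A : Type*} {V : Set (σ → A)} {W : Set (τ → A)} {p : (σ ⊕ τ → A) → Prop} :
    (∀ z ∈ prodSet V W, p z) ↔ ∀ x ∈ V, ∀ y ∈ W, p (Sum.elim x y) :=
  ⟨fun h x hx y hy => h _ (sumElim_mem_prodSet hx hy), fun h z hz => by
    have := h _ hz.1 _ hz.2
    rwa [Sum.elim_comp_inl_inr] at this⟩

/-- A pair of tangent vectors is a tangent vector to the product. -/
theorem sumElim_mem_dualPoints {V : Set (σ → U)} {W : Set (τ → U)} {α : σ → DualNumber U}
    {β : τ → DualNumber U} (hα : α ∈ dualPoints V) (hβ : β ∈ dualPoints W) :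
    Sum.elim α β ∈ dualPoints (prodSet V W) := by
  refine ⟨?_, fun Q hQ => ?_⟩
  · rw [fst_sumElim]
    exact sumElim_mem_prodSet hα.1 hβ.1
  have hQ' : ∀ x ∈ V, ∀ y ∈ W, eval (Sum.elim x y) Q = 0 := forall_prodSet.1 hQ
  have h1 : jet 0 (Sum.elim α (constPoint fun j => (β j).fst)) Q = 0 := by
    have h := hα.2 (bind₁ (Sum.elim X fun j => C (β j).fst) Q) fun x hx => by
      change eval _ _ = 0
      rw [eval_bind₁_eq]
      convert hQ' x hx _ hβ.1 using 3
      funext j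
      cases j <;> simp
    rw [jet_bind₁] at h
    convert h using 2
    congr 1
    funext j
    cases j <;> simp [constPoint, dualHom]
  have h2 : jet 0 (Sum.elim (constPoint fun j => (α j).fst) β) Q = 0 := by
    have h := hβ.2 (bind₁ (Sum.elim (fun j => C (α j).fst) X) Q) fun y hy => by
      change eval _ _ = 0
      rw [eval_bind₁_eq]
      convert hQ' _ hα.1 y hy using 3
      funext j
      cases j <;> simp
    rw [jet_bind₁] at h
    convert h using 2
    congr 1
    funext j
    cases j <;> simp [constPoint, dualHom]
  ext
  · rw [fst_jet, fst_sumElim, hQ' _ hα.1 _ hβ.1, fst_zero]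
  · rw [snd_jet_sumElim, h1, h2]
    simp

end DualPoints

/-! ### Commutative algebraic groups and their points over the dual numbers -/

/-- A commutative affine algebraic group, given by polynomials over `U`. -/
structure PolyGroup (U : Type u) [Field U] (n : ℕ) where
  carrier : Set (Fin n → U)
  mulPoly : Fin n → MvPolynomial (Fin n ⊕ Fin n) U
  invPoly : Fin n → MvPolynomial (Fin n) U
  one : Fin n → U
  one_mem : one ∈ carrier
  mul_mem : ∀ a ∈ carrier, ∀ b ∈ carrier, (fun j => eval (Sum.elim a b) (mulPoly j)) ∈ carrier
  inv_mem : ∀ a ∈ carrier, (fun j => eval a (invPoly j)) ∈ carrier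
  mul_assoc : ∀ a ∈ carrier, ∀ b ∈ carrier, ∀ c ∈ carrier, ∀ j,
    eval (Sum.elim (fun j => eval (Sum.elim a b) (mulPoly j)) c) (mulPoly j) =
      eval (Sum.elim a (fun j => eval (Sum.elim b c) (mulPoly j))) (mulPoly j)
  one_mul : ∀ a ∈ carrier, ∀ j, eval (Sum.elim one a) (mulPoly j) = a j
  inv_mul : ∀ a ∈ carrier, ∀ j,
    eval (Sum.elim (fun j => eval a (invPoly j)) a) (mulPoly j) = one j
  mul_comm : ∀ a ∈ carrier, ∀ b ∈ carrier, ∀ j,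
    eval (Sum.elim a b) (mulPoly j) = eval (Sum.elim b a) (mulPoly j)

namespace PolyGroup

open TrivSqZeroExt

variable {U : Type u} [Field U] {n : ℕ} (G : PolyGroup U n)

noncomputable instance : Mul G.carrier := ⟨fun a b => ⟨_, G.mul_mem a a.2 b b.2⟩⟩

noncomputable instance : Inv G.carrier := ⟨fun a => ⟨_, G.inv_mem a a.2⟩⟩

instance : One G.carrier := ⟨⟨G.one, G.one_mem⟩⟩

noncomputable instance : CommGroup G.carrier :=
  { Group.ofLeftAxioms (G := G.carrier)
      (fun a b c => Subtype.ext (funext (G.mul_assoc a a.2 b b.2 c c.2)))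
      (fun a => Subtype.ext (funext (G.one_mul a a.2)))
      (fun a => Subtype.ext (funext (G.inv_mul a a.2))) with
    mul_comm := fun a b => Subtype.ext (funext (G.mul_comm a a.2 b b.2)) }

theorem coe_mul (a b : G.carrier) (j : Fin n) :
    (a * b : G.carrier).1 j = eval (Sum.elim a.1 b.1) (G.mulPoly j) := rfl

theorem coe_inv (a : G.carrier) (j : Fin n) :
    (a⁻¹ : G.carrier).1 j = eval a.1 (G.invPoly j) := rfl

theorem coe_one : ((1 : G.carrier) : Fin n → U) = G.one := rfl

noncomputable instance : Mul (dualPoints G.carrier) :=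
  ⟨fun α β => ⟨fun j => jet 0 (Sum.elim α.1 β.1) (G.mulPoly j),
    mem_dualPoints_of_mapsTo _ (forall_prodSet.2 G.mul_mem) (sumElim_mem_dualPoints α.2 β.2)⟩⟩

noncomputable instance : Inv (dualPoints G.carrier) :=
  ⟨fun α => ⟨fun j => jet 0 α.1 (G.invPoly j), mem_dualPoints_of_mapsTo _ G.inv_mem α.2⟩⟩

noncomputable instance : One (dualPoints G.carrier) :=
  ⟨⟨constPoint G.one, constPoint_mem_dualPoints G.one_mem⟩⟩

theorem dual_coe_mul (α β : dualPoints G.carrier) (j : Fin n) :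
    (α * β : dualPoints G.carrier).1 j = jet 0 (Sum.elim α.1 β.1) (G.mulPoly j) := rfl

theorem dual_coe_inv (α : dualPoints G.carrier) (j : Fin n) :
    (α⁻¹ : dualPoints G.carrier).1 j = jet 0 α.1 (G.invPoly j) := rfl

theorem dual_coe_one : ((1 : dualPoints G.carrier) : Fin n → DualNumber U) = constPoint G.one :=
  rfl

theorem dual_mul_assoc (α β γ : dualPoints G.carrier) : α * β * γ = α * (β * γ) := by
  refine Subtype.ext (funext fun j => ?_)
  have h := jet_eq_of_eqOn
    (P := bind₁ (Sum.elim (fun l => rename Sum.inl (G.mulPoly l)) fun l => X (Sum.inr l))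
      (G.mulPoly j))
    (Q := bind₁ (Sum.elim (fun l => X (Sum.inl (Sum.inl l)))
      fun l => rename (Sum.elim (Sum.inl ∘ Sum.inr) Sum.inr) (G.mulPoly l)) (G.mulPoly j))
    (forall_prodSet.2 fun z hz c hc => by
      have := G.mul_assoc _ hz.1 _ hz.2 c hc j
      rw [eval_bind₁_eq, eval_bind₁_eq]
      convert this using 3
      · funext l
        cases l with
        | inl l => simp [eval_rename, Sum.elim_comp_inl_inr]
        | inr l => simp
      · funext l
        cases l with
        | inl l => simp
        | inr l =>
          simp only [Sum.elim_inr, eval_rename]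
          congr 2
          funext i
          cases i <;> rfl)
    (sumElim_mem_dualPoints (sumElim_mem_dualPoints α.2 β.2) γ.2)
  rw [jet_bind₁, jet_bind₁] at h
  have jet_rename : ∀ {σ τ : Type} (f : σ → τ) (α : τ → DualNumber U) (P : MvPolynomial σ U),
      jet 0 α (rename f P) = jet 0 (α ∘ f) P := fun f α P => by
    simp [jet, eval₂_rename]
  rw [dual_coe_mul, dual_coe_mul]
  convert h using 3
  · funext l
    cases l with
    | inl l => simp [jet_rename, dual_coe_mul]
    | inr l => simp
  · funext l
    cases l with
    | inl l => simp
    | inr l =>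
      simp only [Sum.elim_inr, jet_rename, dual_coe_mul]
      congr 2
      funext i
      cases i <;> rfl

theorem dual_one_mul (α : dualPoints G.carrier) : 1 * α = α := by
  refine Subtype.ext (funext fun j => ?_)
  have h := jet_eq_of_eqOn (P := bind₁ (Sum.elim (fun l => C (G.one l)) X) (G.mulPoly j)) (Q := X j)
    (fun x hx => by
      rw [eval_bind₁_eq, eval_X, ← G.one_mul x hx j]
      congr 2
      funext l
      cases l <;> simp) α.2
  rw [jet_bind₁, jet_X] at h
  rw [← h, dual_coe_mul]
  congr 2
  funext l
  cases l <;> simp [dual_coe_one, constPoint, dualHom]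

theorem dual_inv_mul (α : dualPoints G.carrier) : α⁻¹ * α = 1 := by
  refine Subtype.ext (funext fun j => ?_)
  have h := jet_eq_of_eqOn (P := bind₁ (Sum.elim G.invPoly X) (G.mulPoly j)) (Q := C (G.one j))
    (fun x hx => by
      rw [eval_bind₁_eq, eval_C, ← G.inv_mul x hx j]
      congr 2
      funext l
      cases l <;> simp) α.2
  rw [jet_bind₁, jet_C] at h
  rw [dual_coe_one, dual_coe_mul]
  convert h using 1
  · congr 2
    funext l
    cases l <;> simp [dual_coe_inv]
  · simp [constPoint, dualHom]

theorem dual_mul_comm (α β : dualPoints G.carrier) : α * β = β * α := by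
  refine Subtype.ext (funext fun j => ?_)
  have h := jet_eq_of_eqOn (P := bind₁ (Sum.elim (X ∘ Sum.inr) (X ∘ Sum.inl)) (G.mulPoly j))
    (Q := G.mulPoly j)
    (forall_prodSet.2 fun a ha b hb => by
      rw [eval_bind₁_eq, G.mul_comm a ha b hb j]
      congr 2
      funext l
      cases l <;> simp) (sumElim_mem_dualPoints α.2 β.2)
  rw [jet_bind₁] at h
  rw [dual_coe_mul, dual_coe_mul, ← h]
  congr 2
  funext l
  cases l <;> simp

/-- The polynomial identities that make `G` a commutative group also hold over the dual numbers. -/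
noncomputable instance : CommGroup (dualPoints G.carrier) :=
  { Group.ofLeftAxioms G.dual_mul_assoc G.dual_one_mul G.dual_inv_mul with
    mul_comm := G.dual_mul_comm }

/-- The inclusion of `G` into its group of points over the dual numbers. -/
noncomputable def constHom : G.carrier →* dualPoints G.carrier where
  toFun a := ⟨constPoint a.1, constPoint_mem_dualPoints a.2⟩
  map_one' := rfl
  map_mul' a b := Subtype.ext (funext fun j => by
    have : Sum.elim (constPoint a.1) (constPoint b.1) = constPoint (Sum.elim a.1 b.1) := by
      funext l
      cases l <;> rfl
    rw [dual_coe_mul, this, jet_zero_constPoint]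
    rfl)

/-- The projection of the points over the dual numbers to the underlying points of `G`. -/
noncomputable def fstHom : dualPoints G.carrier →* G.carrier where
  toFun α := ⟨fun j => (α.1 j).fst, α.2.1⟩
  map_one' := Subtype.ext (funext fun j => by simp [dual_coe_one, coe_one])
  map_mul' α β := Subtype.ext (funext fun j => by
    simp only [dual_coe_mul, coe_mul, fst_jet, fst_sumElim])

/-- On tangent vectors at the identity the group law is addition. -/
theorem snd_mul_of_fst_eq_one (α β : dualPoints G.carrier) (hα : G.fstHom α = 1)
    (hβ : G.fstHom β = 1) (j : Fin n) :
    ((α * β).1 j).snd = (α.1 j).snd + (β.1 j).snd := by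
  have hα' : (fun j => (α.1 j).fst) = G.one := congrArg Subtype.val hα
  have hβ' : (fun j => (β.1 j).fst) = G.one := congrArg Subtype.val hβ
  rw [dual_coe_mul, snd_jet_sumElim, hα', hβ', ← dual_coe_one, ← dual_coe_mul, ← dual_coe_mul,
    _root_.one_mul, mul_one]

/-- A section of the tangent bundle of `G` that is a group homomorphism. -/
structure IsHomSection (s : (Fin n → U) → Fin n → U) : Prop where
  mem : ∀ a ∈ G.carrier, jetPoint a (s a) ∈ dualPoints G.carrier
  map_mul : ∀ a b : G.carrier, ∀ j,
    s (a * b : G.carrier).1 j = (jet 0 (Sum.elim (jetPoint a.1 (s a.1)) (jetPoint b.1 (s b.1)))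
      (G.mulPoly j)).snd

variable {G} {s : (Fin n → U) → Fin n → U} (hs : G.IsHomSection s)

/-- A homomorphic section of the tangent bundle, as a homomorphism to `G(U[ε])`. -/
noncomputable def IsHomSection.hom : G.carrier →* dualPoints G.carrier :=
  MonoidHom.mk' (fun a => ⟨jetPoint a.1 (s a.1), hs.mem a.1 a.2⟩) fun a b =>
    Subtype.ext (funext fun j => by
      rw [dual_coe_mul]
      ext
      · simp [fst_jet, fst_sumElim, coe_mul]
      · simpa using hs.map_mul a b j)

/-- The logarithmic derivative `a ↦ s(a) a⁻¹`, with values in the tangent space at the identity. -/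
noncomputable def IsHomSection.logHom : G.carrier →* dualPoints G.carrier :=
  hs.hom / G.constHom

theorem IsHomSection.fstHom_logHom (a : G.carrier) : G.fstHom (hs.logHom a) = 1 := by
  have h1 : G.fstHom (hs.hom a) = a := Subtype.ext (funext fun j => by
    change (jetPoint a.1 (s a.1) j).fst = a.1 j
    simp)
  have h2 : G.fstHom (G.constHom a) = a := Subtype.ext (funext fun j => by
    change (constPoint a.1 j).fst = a.1 j
    simp)
  rw [logHom, MonoidHom.div_apply, map_div, h1, h2, div_self']

/-- The logarithmic derivative as a vector. -/
noncomputable def IsHomSection.log (a : G.carrier) : Fin n → U := fun j => ((hs.logHom a).1 j).snd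

theorem IsHomSection.logHom_eq (a : G.carrier) :
    (hs.logHom a).1 = jetPoint G.one (hs.log a) := by
  funext j
  ext
  · have := congrFun (congrArg Subtype.val (hs.fstHom_logHom a)) j
    rw [jetPoint, fst_add, fst_inl, fst_inr, add_zero]
    exact this
  · simp [log]

theorem IsHomSection.log_mul (a b : G.carrier) : hs.log (a * b) = hs.log a + hs.log b := by
  funext j
  rw [log, _root_.map_mul]
  exact G.snd_mul_of_fst_eq_one _ _ (hs.fstHom_logHom a) (hs.fstHom_logHom b) j

theorem IsHomSection.hom_eq (a : G.carrier) : hs.hom a = hs.logHom a * G.constHom a := by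
  rw [logHom, MonoidHom.div_apply, div_mul_cancel]

theorem IsHomSection.eq_zero_of_log_eq_zero {a : G.carrier} (h : hs.log a = 0) : s a.1 = 0 := by
  have h1 : hs.logHom a = 1 := Subtype.ext (by
    rw [hs.logHom_eq, h, dual_coe_one]
    funext j
    simp [jetPoint, constPoint])
  have h2 := hs.hom_eq a
  rw [h1, _root_.one_mul] at h2
  funext j
  have := congrArg (fun α => (α.1 j).snd) h2
  change (jetPoint a.1 (s a.1) j).snd = (constPoint a.1 j).snd at this
  simpa using this

theorem IsHomSection.log_apply (a : G.carrier) (j : Fin n) :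
    hs.log a j = (jet 0 (Sum.elim (jetPoint a.1 (s a.1))
      (constPoint fun l => eval a.1 (G.invPoly l))) (G.mulPoly j)).snd := by
  rw [log, logHom, MonoidHom.div_apply, div_eq_mul_inv, ← map_inv, dual_coe_mul]
  rfl

/-- A polynomial that restricts to a homomorphism from `G` to the additive group has a derivative
in the direction of `s` that depends only on the logarithmic derivative, and linearly. -/
theorem IsHomSection.snd_jet_additive (P : MvPolynomial (Fin n) U)
    (hP : ∀ a b : G.carrier, eval (a * b : G.carrier).1 P = eval a.1 P + eval b.1 P)
    (a : G.carrier) :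
    (jet 0 (jetPoint a.1 (s a.1)) P).snd = (jet 0 (jetPoint G.one (hs.log a)) P).snd := by
  have key : ∀ α β : dualPoints G.carrier,
      jet 0 (α * β).1 P = jet 0 α.1 P + jet 0 β.1 P := fun α β => by
    have h := jet_eq_of_eqOn (P := bind₁ G.mulPoly P)
      (Q := bind₁ (X ∘ Sum.inl) P + bind₁ (X ∘ Sum.inr) P)
      (forall_prodSet.2 fun x hx y hy => by
        have := hP ⟨x, hx⟩ ⟨y, hy⟩
        rw [map_add, eval_bind₁_eq, eval_bind₁_eq, eval_bind₁_eq]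
        simpa [funext (coe_mul G ⟨x, hx⟩ ⟨y, hy⟩)] using this)
      (sumElim_mem_dualPoints α.2 β.2)
    rw [map_add, jet_bind₁, jet_bind₁, jet_bind₁] at h
    simp only [Function.comp_apply, jet_X, Sum.elim_inl, Sum.elim_inr] at h
    exact h
  have h := congrArg TrivSqZeroExt.snd (key (hs.logHom a) (G.constHom a))
  rw [← hs.hom_eq, hs.logHom_eq, snd_add] at h
  refine h.trans ?_
  have : jet 0 (G.constHom a).1 P = _ := jet_zero_constPoint a.1 P
  rw [this, snd_inl, add_zero]

end PolyGroup

/-! ### The logarithmic derivative of a commutative `D`-group over constants -/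

open TrivSqZeroExt

section JetsOverConstants

variable {U : Type u} [Field U] {K : Subfield U} {σ τ : Type}

theorem aeval_coe_eq (e : σ → K) (P : MvPolynomial σ K) :
    aeval (fun j => (e j : U)) P = (eval e P : K) := by
  induction P using MvPolynomial.induction_on with
  | C a => simp; rfl
  | add p q hp hq => simp [hp, hq]
  | mul_X p j hp => simp [hp]

theorem jetPoint_sumElim (a u : σ → U) (b v : τ → U) :
    jetPoint (Sum.elim a b) (Sum.elim u v) = Sum.elim (jetPoint a u) (jetPoint b v) := by
  funext j
  cases j <;> rfl

theorem prolongEval_eq_snd_jet_zero [Fintype σ] {d : Derivation ℤ U U} (hd : ∀ c ∈ K, d c = 0)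
    (P : MvPolynomial σ K) (x u : σ → U) :
    prolongEval d P x u = (jet 0 (jetPoint x u) (map (algebraMap K U) P)).snd := by
  rw [prolongEval_congr (d' := 0) hd, prolongEval_eq_snd_jet]

theorem prolongEval_eq_sum [Fintype σ] {d : Derivation ℤ U U} (hd : ∀ c ∈ K, d c = 0)
    (P : MvPolynomial σ K) (x u : σ → U) :
    prolongEval d P x u = ∑ j, aeval x (pderiv j P) * u j := by
  have : coeffDeriv d P = 0 := by
    ext e
    rw [coeff_coeffDeriv, hd _ (coeff e P).2, coeff_zero]
  rw [prolongEval, this, map_zero, add_zero]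

theorem jet_zero_derivation [Fintype σ] {d : Derivation ℤ U U} (hd : ∀ c ∈ K, d c = 0)
    (P : MvPolynomial σ K) (x : σ → U) :
    jet 0 (jetPoint x fun j => d (x j)) (map (algebraMap K U) P) =
      inl (aeval x P) + inr (d (aeval x P)) := by
  ext
  · simp [fst_jet, aeval_eq_eval_map]
  · rw [← prolongEval_eq_snd_jet_zero hd, prolongEval_derivation]
    simp

end JetsOverConstants

namespace DGroup

variable {U : Type u} [Field U] {m : ℕ} {δ : Fin m → Derivation ℤ U U} {k : Subfield U}

/-- A commutative `D`-group, as a commutative algebraic group over `U`. -/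
noncomputable def toPolyGroup (G : DGroup δ k) (hcomm : G.IsCommutative) : PolyGroup U G.n where
  carrier := G.carrier
  mulPoly j := map (algebraMap k U) (G.mulPoly j)
  invPoly j := map (algebraMap k U) (G.invPoly j)
  one j := G.one j
  one_mem := G.one_mem
  mul_mem a ha b hb := by
    simp only [← aeval_eq_eval_map]
    exact G.mul_mem a ha b hb
  inv_mem a ha := by
    simp only [← aeval_eq_eval_map]
    exact G.inv_mem a ha
  mul_assoc a ha b hb c hc j := by
    simp only [← aeval_eq_eval_map]
    exact congrFun (G.mul_assoc a ha b hb c hc) j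
  one_mul a ha j := by
    simp only [← aeval_eq_eval_map]
    exact congrFun (G.one_mul a ha) j
  inv_mul a ha j := by
    simp only [← aeval_eq_eval_map]
    exact congrFun (G.inv_mul a ha) j
  mul_comm a ha b hb j := by
    simp only [← aeval_eq_eval_map]
    exact congrFun (hcomm a ha b hb) j

variable [CharZero U] [IsAlgClosed U]

/-- Over constants the prolongation is the tangent bundle, so the section of a `D`-group is a
homomorphic section of the tangent bundle. -/
theorem isHomSection (hk : k ≤ constants δ) (G : DGroup δ k) (hcomm : G.IsCommutative)
    (i : Fin m) : (G.toPolyGroup hcomm).IsHomSection (G.sec i) where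
  mem a ha := by
    have hd : ∀ c ∈ k, δ i c = 0 := fun c hc => hk hc i
    obtain ⟨S, hS⟩ := G.regular i
    refine ⟨by simpa using ha, fun Q hQ => ?_⟩
    have := jet_eq_zero_of_mem_vanishingIdeal (K := k) 0 (fun x hx => by simp) G.isClosed S
      (fun x hx P hP => by
        have h := G.sec_mem i x hx P hP
        rw [hS x hx, prolongEval_congr (d' := 0) hd] at h
        exact h) hQ ha
    rw [hS a ha]
    exact this
  map_mul a b j := by
    have hd : ∀ c ∈ k, δ i c = 0 := fun c hc => hk hc i
    have h := congrFun (G.sec_mul i a.1 a.2 b.1 b.2) j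
    rw [prolongEval_eq_snd_jet_zero hd, jetPoint_sumElim] at h
    refine Eq.trans (congrFun (congrArg (G.sec i) (funext fun l => ?_)) j) h
    exact (aeval_eq_eval_map _ _).symm

/-- Quotients of `D`-points are `D`-points. -/
theorem sec_div_eq (hk : k ≤ constants δ) (G : DGroup δ k) (hcomm : G.IsCommutative) (i : Fin m)
    (a b : (G.toPolyGroup hcomm).carrier) (ha : G.sec i a.1 = fun j => δ i (a.1 j))
    (hb : G.sec i b.1 = fun j => δ i (b.1 j)) :
    G.sec i (a / b).1 = fun j => δ i ((a / b).1 j) := by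
  have hd : ∀ c ∈ k, δ i c = 0 := fun c hc => hk hc i
  let hs := G.isHomSection hk hcomm i
  have hom_eq : ∀ c, (hs.hom c).1 = jetPoint c.1 (G.sec i c.1) := fun c => rfl
  have hinv : ((hs.hom b)⁻¹).1 = jetPoint (b⁻¹).1 fun j => δ i ((b⁻¹).1 j) := by
    funext j
    rw [PolyGroup.dual_coe_inv, hom_eq, hb]
    refine (jet_zero_derivation hd (G.invPoly j) b.1).trans ?_
    rw [aeval_eq_eval_map]
    rfl
  have hdiv : (hs.hom (a / b)).1 = jetPoint (a / b).1 fun j => δ i ((a / b).1 j) := by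
    funext j
    have : Sum.elim (fun j => δ i (a.1 j)) (fun j => δ i ((b⁻¹).1 j)) =
        fun j => δ i (Sum.elim a.1 (b⁻¹).1 j) := by
      funext j
      cases j <;> rfl
    rw [_root_.map_div, div_eq_mul_inv, div_eq_mul_inv, PolyGroup.dual_coe_mul, hinv, hom_eq, ha,
      ← jetPoint_sumElim, this]
    refine (jet_zero_derivation hd (G.mulPoly j) _).trans ?_
    rw [aeval_eq_eval_map]
    rfl
  funext j
  have := congrArg TrivSqZeroExt.snd (congrFun hdiv j)
  rw [hom_eq] at this
  simpa using this

/-- The logarithmic derivatives `λᵢ : a ↦ sᵢ(a) a⁻¹` of a commutative `D`-group over constants are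
polynomial homomorphisms to a vector space; `sᵢ` acts on them linearly, and it vanishes where `λᵢ`
does. -/
theorem exists_logDerivative (hk : k ≤ constants δ) (G : DGroup δ k) (hcomm : G.IsCommutative) :
    ∃ (L : Fin m → Fin G.n → MvPolynomial (Fin G.n) k) (A : Fin m → Fin G.n → Fin G.n → k),
      (∀ i r, ∀ a b : (G.toPolyGroup hcomm).carrier,
        aeval (a * b).1 (L i r) = aeval a.1 (L i r) + aeval b.1 (L i r)) ∧
      (∀ i j r, ∀ a ∈ G.carrier, prolongEval (δ i) (L j r) a (G.sec i a) =
        ∑ l, (A j r l : U) * aeval a (L i l)) ∧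
      ∀ i, ∀ a ∈ G.carrier, (∀ r, aeval a (L i r) = 0) → G.sec i a = 0 := by
  have hd : ∀ i, ∀ c ∈ k, δ i c = 0 := fun i c hc => hk hc i
  choose S hS using G.regular
  let hs := G.isHomSection hk hcomm
  -- The prolongation of the multiplication at `(a, a⁻¹)`, applied to the tangent vector `(sᵢ(a), 0)`.
  let L : Fin m → Fin G.n → MvPolynomial (Fin G.n) k := fun i r =>
    ∑ l, bind₁ (Sum.elim X G.invPoly) (pderiv (Sum.inl l) (G.mulPoly r)) * S i l
  have hL : ∀ i r, ∀ a : (G.toPolyGroup hcomm).carrier,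
      aeval a.1 (L i r) = (hs i).log a r := by
    intro i r a
    have h : constPoint (fun l => eval a.1 ((G.toPolyGroup hcomm).invPoly l)) =
        jetPoint (fun l => aeval a.1 (G.invPoly l)) 0 := by
      funext l
      simp only [aeval_eq_eval_map]
      simp [constPoint, jetPoint, toPolyGroup]
    rw [(hs i).log_apply, h, ← jetPoint_sumElim]
    refine Eq.trans ?_ (prolongEval_eq_snd_jet_zero (hd i) (G.mulPoly r) _ _)
    rw [prolongEval_eq_sum (hd i), Fintype.sum_sum_type]
    simp only [L, map_sum, map_mul, aeval_bind₁, Sum.elim_inl, Sum.elim_inr, Pi.zero_apply,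
      mul_zero, Finset.sum_const_zero, add_zero]
    refine Finset.sum_congr rfl fun l _ => ?_
    rw [hS i a.1 a.2, polyMap]
    congr 3
    funext v
    cases v <;> simp
  -- The matrices are the differentials of the `λⱼ` at the identity.
  refine ⟨L, fun j r l => eval G.one (pderiv l (L j r)), ?_, ?_, ?_⟩
  · intro i r a b
    rw [hL, hL, hL, (hs i).log_mul, Pi.add_apply]
  · intro i j r a ha
    rw [prolongEval_eq_snd_jet_zero (hd i)]
    refine ((hs i).snd_jet_additive (map (algebraMap k U) (L j r)) (fun a b => ?_) ⟨a, ha⟩).trans ?_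
    · simp only [← aeval_eq_eval_map, hL]
      rw [(hs j).log_mul, Pi.add_apply]
    · rw [← prolongEval_eq_snd_jet_zero (hd i), prolongEval_eq_sum (hd i)]
      refine Finset.sum_congr rfl fun l _ => ?_
      rw [← hL i l ⟨a, ha⟩]
      congr 1
      exact aeval_coe_eq G.one _
  · intro i a ha h
    have h0 : (hs i).log ⟨a, ha⟩ = 0 := by
      funext r
      rw [← hL]
      exact h r
    exact (hs i).eq_zero_of_log_eq_zero h0

end DGroup

/-! ### Images of varieties under polynomial maps -/

section Dominance

variable {U : Type u} [Field U] {K : Subfield U} {σ τ : Type}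

/-- A `K`-linear functional on `U`, applied to the coefficients of a polynomial. -/
noncomputable def coeffFunctional (φ : U →ₗ[K] K) (P : MvPolynomial σ U) : MvPolynomial σ K :=
  ∑ e ∈ P.support, monomial e (φ (coeff e P))

theorem coeff_coeffFunctional (φ : U →ₗ[K] K) (P : MvPolynomial σ U) (e : σ →₀ ℕ) :
    coeff e (coeffFunctional φ P) = φ (coeff e P) := by
  classical
  simp only [coeffFunctional, coeff_sum, coeff_monomial]
  rw [Finset.sum_ite_eq' P.support e]
  split_ifs with h
  · rfl
  · rw [notMem_support_iff.1 h, map_zero]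

theorem coeffFunctional_add (φ : U →ₗ[K] K) (P Q : MvPolynomial σ U) :
    coeffFunctional φ (P + Q) = coeffFunctional φ P + coeffFunctional φ Q := by
  ext e
  simp [coeff_coeffFunctional]

theorem coeffFunctional_C (φ : U →ₗ[K] K) (c : U) :
    coeffFunctional φ (C c : MvPolynomial σ U) = C (φ c) := by
  classical
  ext e
  rw [coeff_coeffFunctional, coeff_C, coeff_C]
  split_ifs <;> simp

theorem coeffFunctional_mul_map (φ : U →ₗ[K] K) (P : MvPolynomial σ U) (Q : MvPolynomial σ K) :
    coeffFunctional φ (P * map (algebraMap K U) Q) = coeffFunctional φ P * Q := by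
  classical
  induction Q using MvPolynomial.induction_on generalizing P with
  | C a =>
    ext e
    rw [coeff_coeffFunctional, map_C, mul_comm, coeff_C_mul, mul_comm _ (C a), coeff_C_mul,
      coeff_coeffFunctional, ← Algebra.smul_def, map_smul, smul_eq_mul]
  | add p q hp hq => rw [map_add, mul_add, coeffFunctional_add, hp, hq, mul_add]
  | mul_X p j hp =>
    rw [map_mul, map_X, ← mul_assoc, ← mul_assoc, ← hp]
    ext e
    rw [coeff_coeffFunctional, coeff_mul_X', coeff_mul_X', coeff_coeffFunctional]
    split_ifs <;> simp

theorem coeffFunctional_bind₁ (φ : U →ₗ[K] K) (f : σ → MvPolynomial τ K) (P : MvPolynomial σ U) :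
    coeffFunctional φ (bind₁ (fun j => map (algebraMap K U) (f j)) P) =
      bind₁ f (coeffFunctional φ P) := by
  classical
  induction P using MvPolynomial.induction_on'' with
  | C a => rw [bind₁_C_right, coeffFunctional_C, coeffFunctional_C, bind₁_C_right]
  | monomial_add a b p _ _ hp hm =>
    rw [map_add, coeffFunctional_add, coeffFunctional_add, map_add, hp, hm]
  | mul_X p j hp =>
    rw [map_mul, bind₁_X_right, coeffFunctional_mul_map, hp]
    have : coeffFunctional φ (p * X j) = coeffFunctional φ p * X j := by
      rw [← coeffFunctional_mul_map, map_X]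
    rw [this, map_mul, bind₁_X_right]

theorem coeffFunctional_mem (φ : U →ₗ[K] K) {I : Ideal (MvPolynomial σ K)}
    {P : MvPolynomial σ U} (hP : P ∈ I.map (map (algebraMap K U))) : coeffFunctional φ P ∈ I := by
  induction hP using Submodule.span_induction generalizing φ with
  | mem x hx =>
    obtain ⟨Q, hQ, rfl⟩ := hx
    rw [← one_mul (map (algebraMap K U) Q), coeffFunctional_mul_map]
    exact I.mul_mem_left _ hQ
  | zero => simp [coeffFunctional]
  | add x y _ _ hx hy => rw [coeffFunctional_add]; exact I.add_mem (hx φ) (hy φ)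
  | smul c x _ h =>
    rw [smul_eq_mul]
    induction c using MvPolynomial.induction_on with
    | C a =>
      have : coeffFunctional φ (C a * x) =
          coeffFunctional (φ ∘ₗ LinearMap.mulLeft K a) x := by
        ext e
        rw [coeff_coeffFunctional, coeff_coeffFunctional, coeff_C_mul]
        rfl
      rw [this]
      exact h _
    | add p q hp hq => rw [add_mul, coeffFunctional_add]; exact I.add_mem hp hq
    | mul_X p j hp =>
      rw [mul_right_comm, ← map_X (algebraMap K U), coeffFunctional_mul_map]
      exact I.mul_mem_right _ hp

/-- With respect to a basis of `U` over `K`, a polynomial over `U` is a linear combination of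
polynomials over `K`. -/
theorem eval_eq_zero_of_coeffFunctional (P : MvPolynomial σ U) (y : σ → U)
    (h : ∀ φ : U →ₗ[K] K, aeval y (coeffFunctional φ P) = 0) : eval y P = 0 := by
  classical
  let b := Module.Free.chooseBasis K U
  let s := P.support.biUnion fun e => (b.repr (coeff e P)).support
  have hc : ∀ e ∈ P.support, coeff e P = ∑ i ∈ s, ((b.coord i (coeff e P) : K) : U) * b i := by
    intro e he
    conv_lhs => rw [← b.linearCombination_repr (coeff e P), Finsupp.linearCombination_apply,
      Finsupp.sum_of_support_subset _ (Finset.subset_biUnion_of_mem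
        (fun e => (b.repr (coeff e P)).support) he) _ (by simp)]
    exact Finset.sum_congr rfl fun i _ => Algebra.smul_def _ _
  have h' : ∀ i, ∑ e ∈ P.support, ((b.coord i (coeff e P) : K) : U) * e.prod (fun j k => y j ^ k) =
      0 := fun i => by
    have := h (b.coord i)
    rw [coeffFunctional, map_sum] at this
    rw [← this]
    exact Finset.sum_congr rfl fun e _ => by rw [aeval_monomial]; rfl
  have h1 : eval y P = ∑ e ∈ P.support, ∑ i ∈ s,
      b i * (((b.coord i (coeff e P) : K) : U) * e.prod fun j k => y j ^ k) := by
    rw [eval_eq]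
    refine Finset.sum_congr rfl fun e he => ?_
    conv_lhs => rw [hc e he]
    rw [Finset.sum_mul]
    exact Finset.sum_congr rfl fun i _ => by rw [Finsupp.prod]; ring
  rw [h1, Finset.sum_comm]
  exact Finset.sum_eq_zero fun i _ => by rw [← Finset.mul_sum, h' i, mul_zero]

/-- The locus over `K` of the image of a variety over `K` is also its Zariski closure over `U`:
a polynomial relation over `U` decomposes into relations over `K`. -/
theorem isDominant_zeroLocus_comap [CharZero U] [IsAlgClosed U] {n n' : ℕ}
    {V : Set (Fin n → U)} (hV : IsZariskiClosed K V) (f : Fin n' → MvPolynomial (Fin n) K) :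
    IsDominant V (zeroLocus U ((vanishingIdeal K V).comap (bind₁ f))) (polyMap f) := by
  intro P hP y hy
  have h1 : bind₁ (fun j => map (algebraMap K U) (f j)) P ∈ vanishingIdeal U V := fun x hx => by
    change eval x _ = 0
    rw [eval_bind₁_eq]
    simp only [← aeval_eq_eval_map]
    exact hP x hx
  rw [vanishingIdeal_eq_radical_map hV] at h1
  obtain ⟨N, hN⟩ := h1
  rw [← map_pow] at hN
  have h2 : eval y (P ^ N) = 0 := eval_eq_zero_of_coeffFunctional (K := K) _ y fun φ => by
    refine hy _ ?_
    rw [Ideal.mem_comap, ← coeffFunctional_bind₁]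
    exact coeffFunctional_mem φ hN
  rw [map_pow] at h2
  exact eq_zero_of_pow_eq_zero h2

end Dominance

/-! ### Generic fibres -/

section GenericFibre

variable {U : Type u} [Field U] {k : Subfield U} {n n' : ℕ}

theorem le_adjoin (k : Subfield U) (a : Fin n → U) : k ≤ adjoin k a := fun _ hx =>
  Subfield.subset_closure (Or.inl hx)

theorem mem_adjoin (k : Subfield U) (a : Fin n → U) (j : Fin n) : a j ∈ adjoin k a :=
  Subfield.subset_closure (Or.inr ⟨j, rfl⟩)

/-- Two ring homomorphisms to fields with the same kernel differ by an embedding of the field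
generated by the image of the first one. -/
theorem exists_ringHom_of_ker_eq {A F : Type*} [CommRing A] [Field F] (φ : A →+* U) (ψ : A →+* F)
    (h : ∀ x, φ x = 0 ↔ ψ x = 0) (L : Subfield U) (hL : L ≤ Subfield.closure (Set.range φ)) :
    ∃ θ : L →+* F, ∀ x, ∀ hx : φ x ∈ L, θ ⟨φ x, hx⟩ = ψ x := by
  have : (RingHom.ker φ).IsPrime := RingHom.ker_isPrime φ
  let A' := A ⧸ RingHom.ker φ
  let B := FractionRing A'
  let φ' : A' →+* U := RingHom.kerLift φ
  let ψ' : A' →+* F := Ideal.Quotient.lift _ ψ fun a ha => (h a).1 ha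
  have hφ' : Function.Injective φ' := RingHom.kerLift_injective φ
  have hψ' : Function.Injective ψ' := by
    rw [injective_iff_map_eq_zero]
    intro a ha
    obtain ⟨x, rfl⟩ := Ideal.Quotient.mk_surjective a
    exact Ideal.Quotient.eq_zero_iff_mem.2 ((h x).2 ha)
  let f : B →+* U := IsFractionRing.lift hφ'
  let g : B →+* F := IsFractionRing.lift hψ'
  let e : B ≃+* f.fieldRange := RingEquiv.ofBijective f.rangeRestrictField
    ⟨fun x y hxy => f.injective (congrArg Subtype.val hxy), f.rangeRestrict_surjective⟩
  have hf : ∀ x, f (algebraMap A' B (Ideal.Quotient.mk _ x)) = φ x := fun x =>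
    (IsFractionRing.lift_algebraMap hφ' _).trans rfl
  have hle : L ≤ f.fieldRange := hL.trans (Subfield.closure_le.2 (by
    rintro _ ⟨x, rfl⟩
    exact ⟨_, hf x⟩))
  refine ⟨g.comp ((e.symm : f.fieldRange →+* B).comp (Subfield.inclusion hle)), fun x hx => ?_⟩
  have : e.symm (Subfield.inclusion hle ⟨φ x, hx⟩) = algebraMap A' B (Ideal.Quotient.mk _ x) := by
    rw [RingEquiv.symm_apply_eq]
    exact Subtype.ext (hf x).symm
  rw [RingHom.comp_apply, RingHom.comp_apply, RingHom.coe_coe, this]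
  exact (IsFractionRing.lift_algebraMap hψ' _).trans rfl

theorem aeval_map_inclusion {L : Subfield U} (h : k ≤ L) (x : Fin n → U)
    (P : MvPolynomial (Fin n) k) : aeval x (map (Subfield.inclusion h) P) = aeval x P := by
  rw [aeval_def, aeval_def, eval₂_map]
  rfl

/-- The equations over `k(a)` of the fibre over `a` of the polynomial map `f`. -/
def fibreEquations (I : Ideal (MvPolynomial (Fin n) k)) (f : Fin n' → MvPolynomial (Fin n) k)
    (a : Fin n' → U) : Set (MvPolynomial (Fin n) (adjoin k a)) :=
  map (Subfield.inclusion (le_adjoin k a)) '' I ∪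
    Set.range fun j => map (Subfield.inclusion (le_adjoin k a)) (f j) - C ⟨a j, mem_adjoin k a j⟩

/-- The ideal of the generic fibre is prime: up to units of `k(a)` every polynomial over `k(a)` is
congruent to one over `k`, and the ideal contains no more polynomials over `k` than `I`, because
`k(a)` embeds into the residue field of `I`. -/
theorem isPrime_span_fibreEquations (I : Ideal (MvPolynomial (Fin n) k)) [hI : I.IsPrime]
    (f : Fin n' → MvPolynomial (Fin n) k) (a : Fin n' → U)
    (ha : ∀ Q : MvPolynomial (Fin n') k, aeval a Q = 0 ↔ bind₁ f Q ∈ I) :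
    (Ideal.span (fibreEquations I f a)).IsPrime := by
  set J := Ideal.span (fibreEquations I f a)
  let i := Subfield.inclusion (le_adjoin k a)
  let π : MvPolynomial (Fin n) k →+* I.ResidueField := algebraMap _ _
  have hπ : ∀ h, π h = 0 ↔ h ∈ I := fun h => Ideal.algebraMap_residueField_eq_zero
  obtain ⟨θ, hθ⟩ := exists_ringHom_of_ker_eq (aeval a : MvPolynomial (Fin n') k →ₐ[k] U).toRingHom
    (π.comp (bind₁ f).toRingHom) (fun Q => (ha Q).trans (hπ _).symm) (adjoin k a) (by
      refine Subfield.closure_le.2 (Set.union_subset ?_ ?_)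
      · exact fun c hc => Subfield.subset_closure ⟨C ⟨c, hc⟩, aeval_C _ _⟩
      · rintro _ ⟨j, rfl⟩
        exact Subfield.subset_closure ⟨X j, aeval_X _ _⟩)
  set φ := (aeval a : MvPolynomial (Fin n') k →ₐ[k] U).toRingHom
  have hθC : ∀ c : k, θ (i c) = π (C c) := fun c => by
    have h1 : φ (C c) = c := aeval_C _ _
    have h2 : φ (C c) ∈ adjoin k a := h1 ▸ le_adjoin k a c.2
    have h3 : i c = ⟨φ (C c), h2⟩ := Subtype.ext h1.symm
    rw [h3, hθ]
    exact congrArg π (bind₁_C_right _ _)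
  have hθX : ∀ j, θ ⟨a j, mem_adjoin k a j⟩ = π (f j) := fun j => by
    have h1 : φ (X j) = a j := aeval_X _ _
    have h2 : φ (X j) ∈ adjoin k a := h1 ▸ mem_adjoin k a j
    have h3 : (⟨a j, mem_adjoin k a j⟩ : adjoin k a) = ⟨φ (X j), h2⟩ := Subtype.ext h1.symm
    rw [h3, hθ]
    exact congrArg π (bind₁_X_right _ _)
  let Ψ := eval₂Hom θ fun j => π (X j)
  have hΨ : ∀ h, Ψ (map i h) = π h := fun h => by
    have : Ψ.comp (map i) = π := by
      ext
      · simp [Ψ, hθC]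
      · simp [Ψ]
    exact congrArg (fun f => f h) this
  have hJΨ : J ≤ RingHom.ker Ψ := Ideal.span_le.2 (by
    rintro _ (⟨h, hh, rfl⟩ | ⟨j, rfl⟩)
    · exact (hΨ h).trans ((hπ h).2 hh)
    · change Ψ _ = 0
      rw [map_sub, hΨ, sub_eq_zero, ← hθX]
      simp [Ψ])
  have hJI : ∀ h, map i h ∈ J ↔ h ∈ I := fun h =>
    ⟨fun hh => (hπ h).1 ((hΨ h).symm.trans (hJΨ hh)),
      fun hh => Ideal.subset_span (Or.inl ⟨h, hh, rfl⟩)⟩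
  let q := Ideal.Quotient.mk J
  have hq : ∀ h, q (map i h) = 0 ↔ h ∈ I := fun h => by
    rw [Ideal.Quotient.eq_zero_iff_mem, hJI]
  have hqa : ∀ j, q (C ⟨a j, mem_adjoin k a j⟩) = q (map i (f j)) := fun j => by
    have : map i (f j) - C ⟨a j, mem_adjoin k a j⟩ ∈ J :=
      Ideal.subset_span (Or.inr ⟨j, rfl⟩)
    exact (Ideal.Quotient.eq.2 this).symm
  -- Constants of `k(a)` are fractions, modulo `J`, of polynomials over `k`. That the denominator is
  -- congruent to a polynomial over `k` serves the induction steps for sums and inverses.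
  have hconst : ∀ t (ht : t ∈ adjoin k a), ∃ c : adjoin k a, c ≠ 0 ∧
      ∃ h' h, q (C c) = q (map i h') ∧ q (C c) * q (C ⟨t, ht⟩) = q (map i h) := by
    intro t ht
    induction ht using Subfield.closure_induction with
    | mem x hx =>
      rcases hx with hx | ⟨j, rfl⟩
      · exact ⟨1, one_ne_zero, 1, C ⟨x, hx⟩, by simp, by simp; rfl⟩
      · exact ⟨1, one_ne_zero, 1, f j, by simp, by simp [hqa]⟩
    | one => exact ⟨1, one_ne_zero, 1, 1, by simp, by
        rw [← map_mul, ← map_mul, one_mul]; exact congrArg q (by simp; rfl)⟩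
    | add x y hx hy h1 h2 =>
      obtain ⟨c₁, hc₁, h₁', h₁, e₁', e₁⟩ := h1
      obtain ⟨c₂, hc₂, h₂', h₂, e₂', e₂⟩ := h2
      refine ⟨c₁ * c₂, mul_ne_zero hc₁ hc₂, h₁' * h₂', h₁ * h₂' + h₁' * h₂, ?_, ?_⟩
      · simp only [map_mul, e₁', e₂']
      · have : (⟨x + y, Subfield.add_mem _ hx hy⟩ : adjoin k a) = ⟨x, hx⟩ + ⟨y, hy⟩ := rfl
        simp only [this, map_mul, map_add, ← e₁, ← e₂, ← e₁', ← e₂']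
        ring
    | neg x hx h1 =>
      obtain ⟨c₁, hc₁, h₁', h₁, e₁', e₁⟩ := h1
      refine ⟨c₁, hc₁, h₁', -h₁, e₁', ?_⟩
      have : (⟨-x, Subfield.neg_mem _ hx⟩ : adjoin k a) = -⟨x, hx⟩ := rfl
      simp only [this, map_neg, ← e₁]
      ring
    | inv x hx h1 =>
      obtain ⟨c₁, hc₁, h₁', h₁, e₁', e₁⟩ := h1
      have hinv : (⟨x⁻¹, Subfield.inv_mem _ hx⟩ : adjoin k a) = (⟨x, hx⟩)⁻¹ := rfl
      by_cases hx0 : (⟨x, hx⟩ : adjoin k a) = 0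
      · exact ⟨1, one_ne_zero, 1, 0, by simp, by rw [hinv, hx0]; simp⟩
      · refine ⟨c₁ * ⟨x, hx⟩, mul_ne_zero hc₁ hx0, h₁, h₁', ?_, ?_⟩
        · rw [C_mul, map_mul, e₁]
        · rw [hinv, ← map_mul, ← C_mul, mul_inv_cancel_right₀ hx0, e₁']
    | mul x y hx hy h1 h2 =>
      obtain ⟨c₁, hc₁, h₁', h₁, e₁', e₁⟩ := h1
      obtain ⟨c₂, hc₂, h₂', h₂, e₂', e₂⟩ := h2
      refine ⟨c₁ * c₂, mul_ne_zero hc₁ hc₂, h₁' * h₂', h₁ * h₂, ?_, ?_⟩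
      · simp only [map_mul, e₁', e₂']
      · have : (⟨x * y, Subfield.mul_mem _ hx hy⟩ : adjoin k a) = ⟨x, hx⟩ * ⟨y, hy⟩ := rfl
        simp only [this, map_mul, ← e₁, ← e₂]
        ring
  have hpoly : ∀ g, ∃ c : adjoin k a, c ≠ 0 ∧
      ∃ h' h, q (C c) = q (map i h') ∧ q (C c) * q g = q (map i h) := by
    intro g
    induction g using MvPolynomial.induction_on with
    | C t => exact hconst t t.2
    | add x y h1 h2 =>
      obtain ⟨c₁, hc₁, h₁', h₁, e₁', e₁⟩ := h1
      obtain ⟨c₂, hc₂, h₂', h₂, e₂', e₂⟩ := h2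
      refine ⟨c₁ * c₂, mul_ne_zero hc₁ hc₂, h₁' * h₂', h₁ * h₂' + h₁' * h₂, ?_, ?_⟩
      · simp only [map_mul, e₁', e₂']
      · simp only [map_mul, map_add, ← e₁, ← e₂, ← e₁', ← e₂']
        ring
    | mul_X x j h1 =>
      obtain ⟨c₁, hc₁, h₁', h₁, e₁', e₁⟩ := h1
      refine ⟨c₁, hc₁, h₁', h₁ * X j, e₁', ?_⟩
      rw [map_mul, map_mul, map_mul, ← e₁, map_X]
      ring
  have hunit : ∀ (c : adjoin k a) g, c ≠ 0 → q (C c) * q g = 0 → q g = 0 := by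
    intro c g hc h
    have : q g = q (C c⁻¹) * (q (C c) * q g) := by
      rw [← mul_assoc, ← map_mul, ← C_mul, inv_mul_cancel₀ hc]
      simp
    rw [this, h, mul_zero]
  refine ⟨fun h => hI.ne_top ?_, fun {g₁ g₂} hg => ?_⟩
  · rw [Ideal.eq_top_iff_one] at h ⊢
    rw [← hJI, map_one]
    exact h
  · obtain ⟨c₁, hc₁, -, h₁, -, e₁⟩ := hpoly g₁
    obtain ⟨c₂, hc₂, -, h₂, -, e₂⟩ := hpoly g₂
    have h12 : h₁ * h₂ ∈ I := by
      rw [← hq, map_mul, map_mul, ← e₁, ← e₂]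
      have : q (C c₁) * q g₁ * (q (C c₂) * q g₂) = q (C c₁) * q (C c₂) * q (g₁ * g₂) := by
        rw [map_mul q g₁]
        ring
      rw [this, Ideal.Quotient.eq_zero_iff_mem.2 hg, mul_zero]
    rcases hI.mem_or_mem h12 with h | h
    · left
      rw [← Ideal.Quotient.eq_zero_iff_mem]
      exact hunit c₁ g₁ hc₁ (e₁.trans ((hq _).2 h))
    · right
      rw [← Ideal.Quotient.eq_zero_iff_mem]
      exact hunit c₂ g₂ hc₂ (e₂.trans ((hq _).2 h))

end GenericFibre

/-! ### Fibres, images and points of `D`-varieties -/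

section Tools

variable {U : Type u} [Field U] {m : ℕ} {δ : Fin m → Derivation ℤ U U} {K L : Subfield U} {n : ℕ}

theorem aeval_mem_adjoin (h : K ≤ L) (x : Fin n → U) (hx : ∀ j, x j ∈ L)
    (P : MvPolynomial (Fin n) K) : aeval x P ∈ L := by
  induction P using MvPolynomial.induction_on with
  | C a => rw [aeval_C]; exact h a.2
  | add p q hp hq => rw [map_add]; exact L.add_mem hp hq
  | mul_X p j hp => rw [map_mul, aeval_X]; exact L.mul_mem hp (hx j)

theorem isDiffSubfield_adjoin (hK : IsDiffSubfield δ K) (a : Fin n → U)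
    (ha : ∀ i j, δ i (a j) ∈ adjoin K a) : IsDiffSubfield δ (adjoin K a) := by
  intro i x hx
  induction hx using Subfield.closure_induction with
  | mem x hx =>
    rcases hx with hx | ⟨j, rfl⟩
    · exact le_adjoin K a (hK i x hx)
    · exact ha i j
  | one => simp
  | add x y hx hy h1 h2 => rw [map_add]; exact Subfield.add_mem _ h1 h2
  | neg x hx h1 => rw [map_neg]; exact Subfield.neg_mem _ h1
  | inv x hx h1 =>
    rw [Derivation.leibniz_inv, smul_eq_mul]
    exact Subfield.mul_mem _ (Subfield.neg_mem _ (Subfield.pow_mem _ (Subfield.inv_mem _ hx) 2)) h1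
  | mul x y hx hy h1 h2 =>
    rw [Derivation.leibniz, smul_eq_mul, smul_eq_mul]
    exact Subfield.add_mem _ (Subfield.mul_mem _ hx h2) (Subfield.mul_mem _ hy h1)

theorem isDiffSubfield_of_le_constants (hK : K ≤ constants δ) : IsDiffSubfield δ K :=
  fun i x hx => by rw [hK hx i]; exact K.zero_mem

theorem IsIrreducibleOver.nonempty {V : Set (Fin n → U)} (hV : IsIrreducibleOver K V) :
    V.Nonempty := by
  rw [Set.nonempty_iff_ne_empty]
  rintro rfl
  exact hV.ne_top vanishingIdeal_empty

theorem mem_of_forall_vanishingIdeal {V : Set (Fin n → U)} (hV : IsZariskiClosed K V)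
    {x : Fin n → U} (hx : ∀ P ∈ vanishingIdeal K V, aeval x P = 0) : x ∈ V := by
  obtain ⟨I, rfl⟩ := hV
  exact fun P hP => hx P (le_vanishingIdeal_zeroLocus I hP)

theorem prolongEval_map_inclusion (h : K ≤ L) (d : Derivation ℤ U U)
    (P : MvPolynomial (Fin n) K) (x u : Fin n → U) :
    prolongEval d (map (Subfield.inclusion h) P) x u = prolongEval d P x u := by
  rw [prolongEval_eq_snd_jet, prolongEval_eq_snd_jet, map_map]
  rfl

end Tools

namespace DVariety

variable {U : Type u} [Field U] {m : ℕ} {δ : Fin m → Derivation ℤ U U} {K : Subfield U}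

/-- A polynomial map compatible with the sections maps `D`-points to `D`-points. -/
theorem isDMorphism_polyMap (V W : DVariety δ K) (P : Fin W.n → MvPolynomial (Fin V.n) K)
    (hmaps : ∀ x ∈ V.carrier, polyMap P x ∈ W.carrier)
    (hsec : ∀ i, ∀ x ∈ V.carrier, W.sec i (polyMap P x) =
      fun j => prolongEval (δ i) (P j) x (V.sec i x)) :
    IsDMorphism K V W (polyMap P) where
  regular := ⟨P, fun _ _ => rfl⟩
  mapsTo := hmaps
  mapsTo_dPoints x hx := ⟨hmaps x hx.1, fun i => by
    rw [hsec i x hx.1, hx.2 i]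
    funext j
    exact prolongEval_derivation _ _ _⟩

/-- The fibre of a dominant `D`-morphism over a generic `D`-point `a` is a `D`-subvariety over
`K(a)`, irreducible over `K(a)`. -/
theorem isDSubvariety_fibre [IsAlgClosed U] (V W : DVariety δ K)
    (hirr : IsIrreducibleOver K V.carrier) (P : Fin W.n → MvPolynomial (Fin V.n) K)
    (hmaps : ∀ x ∈ V.carrier, polyMap P x ∈ W.carrier)
    (hsec : ∀ i, ∀ x ∈ V.carrier, W.sec i (polyMap P x) =
      fun j => prolongEval (δ i) (P j) x (V.sec i x))
    (hdom : IsDominant V.carrier W.carrier (polyMap P)) {a : Fin W.n → U} (ha : a ∈ W.dPoints)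
    (hgen : IsGenericPoint K W.carrier a) :
    V.IsDSubvariety (adjoin K a) {x | x ∈ V.carrier ∧ polyMap P x = a} ∧
      IsIrreducibleOver (adjoin K a) {x | x ∈ V.carrier ∧ polyMap P x = a} := by
  have hI : (vanishingIdeal K V.carrier).IsPrime := hirr
  have hker : ∀ Q : MvPolynomial (Fin W.n) K,
      aeval a Q = 0 ↔ bind₁ P Q ∈ vanishingIdeal K V.carrier := by
    refine fun Q => ⟨fun h x hx => ?_, fun h => ?_⟩
    · rw [aeval_bind₁]
      exact hgen.2 Q h _ (hmaps x hx)
    · rw [aeval_eq_eval_map]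
      refine hdom _ (fun x hx => ?_) a hgen.1
      have := h x hx
      rw [aeval_bind₁, aeval_eq_eval_map] at this
      exact this
  have hprime := isPrime_span_fibreEquations _ P a hker
  have hfib : {x | x ∈ V.carrier ∧ polyMap P x = a} = zeroLocus U
      (Ideal.span (fibreEquations (vanishingIdeal K V.carrier) P a)) := by
    rw [zeroLocus_span]
    ext x
    constructor
    · rintro ⟨hx, rfl⟩ _ (⟨Q, hQ, rfl⟩ | ⟨j, rfl⟩)
      · rw [aeval_map_inclusion]
        exact hQ x hx
      · change aeval x (_ - _) = 0
        rw [map_sub, aeval_map_inclusion, aeval_C]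
        exact sub_self _
    · intro h
      refine ⟨mem_of_forall_vanishingIdeal V.isClosed fun Q hQ => ?_, funext fun j => ?_⟩
      · rw [← aeval_map_inclusion (le_adjoin K a)]
        exact h _ (Or.inl ⟨Q, hQ, rfl⟩)
      · have h1 := h _ (Or.inr ⟨j, rfl⟩)
        change aeval x (_ - _) = 0 at h1
        rw [map_sub, aeval_map_inclusion, aeval_C] at h1
        exact sub_eq_zero.1 h1
  have hvan : vanishingIdeal (adjoin K a) {x | x ∈ V.carrier ∧ polyMap P x = a} =
      Ideal.span (fibreEquations (vanishingIdeal K V.carrier) P a) := by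
    rw [hfib, IsPrime.vanishingIdeal_zeroLocus]
  refine ⟨⟨le_adjoin K a, fun x hx => hx.1, ⟨_, hfib⟩, fun i x hx =>
    mem_prolongation_of_span _ hvan ?_⟩, by rw [IsIrreducibleOver, hvan]; exact hprime⟩
  obtain ⟨hxV, rfl⟩ := hx
  rintro _ (⟨Q, hQ, rfl⟩ | ⟨j, rfl⟩)
  · rw [aeval_map_inclusion, prolongEval_map_inclusion]
    exact V.sec_mem i x hxV Q hQ
  · have h1 := congrFun (hsec i x hxV) j
    have h2 := congrFun (ha.2 i) j
    simp only
    constructor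
    · rw [map_sub, aeval_map_inclusion, aeval_C]
      exact sub_self _
    · rw [prolongEval_eq_snd_jet, map_sub, map_sub, TrivSqZeroExt.snd_sub,
        ← prolongEval_eq_snd_jet, prolongEval_map_inclusion, ← h1, h2, map_C, jet_C, snd_dualHom]
      exact sub_self _

/-- A nonempty `D`-variety over a differential field has a `D`-point. -/
theorem dPoints_nonempty [CharZero U] (hec : IsExistentiallyClosed δ) (V : DVariety δ K)
    (hK : IsDiffSubfield δ K) (hV : V.carrier.Nonempty) : V.dPoints.Nonempty := by
  choose S hS using V.regular
  obtain ⟨x₀, hx₀⟩ := hV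
  have hzero := zeroLocus_map_vanishingIdeal V.isClosed
  obtain ⟨x, hx, hx'⟩ := hec.exists_dPoint (fun i j => map (algebraMap K U) (S i j))
    ((vanishingIdeal K V.carrier).map (map (algebraMap K U))) (fun h => by
      rw [h, zeroLocus_top] at hzero
      rw [← hzero] at hx₀
      exact hx₀)
    (fun i Q hQ => polyDerivation_mem_map_vanishingIdeal (δ i) (hK i) (S i) (fun x hx => by
      have := V.sec_mem i x hx
      rw [hS i x hx] at this
      exact this) hQ)
  have hxV : x ∈ V.carrier := by
    rw [← hzero]
    exact hx
  refine ⟨x, hxV, fun i => ?_⟩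
  rw [hS i x hxV]
  funext j
  rw [hx' i j, ← aeval_eq_eval_map]
  rfl

/-- Affine space with the zero section. -/
def affineSpace [Infinite U] (δ : Fin m → Derivation ℤ U U) (K : Subfield U) (n : ℕ) :
    DVariety δ K where
  n := n
  carrier := Set.univ
  isClosed := ⟨⊥, by rw [zeroLocus_bot]; rfl⟩
  sec _ _ := 0
  regular _ := ⟨0, fun x _ => by funext j; simp [polyMap]⟩
  sec_mem i a _ := by
    intro P hP
    have h0 : P = 0 := by
      have : map (algebraMap K U) P = 0 := MvPolynomial.funext fun x => by
        rw [← aeval_eq_eval_map, map_zero]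
        exact hP x trivial
      exact map_injective _ (algebraMap K U).injective (this.trans (map_zero _).symm)
    subst h0
    rw [prolongEval_eq_snd_jet]
    simp

theorem isIsotrivial_of_polyMap [CharZero U] (V : DVariety δ K)
    (hirr : IsIrreducibleOver K V.carrier) (F : Subfield U) (hF : IsDiffSubfield δ F) (hKF : K ≤ F)
    {n : ℕ} (f : Fin n → MvPolynomial (Fin V.n) F)
    (hf : ∀ x ∈ V.dPoints, ∀ i j, δ i (aeval x (f j)) = 0)
    (hinj : Set.InjOn (polyMap f) V.carrier) : V.IsIsotrivial :=
  ⟨hirr, F, hF, hKF, affineSpace δ _ n, fun _ _ _ => rfl, polyMap f,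
    ⟨⟨f, fun _ _ => rfl⟩, fun _ _ => trivial, fun x hx => ⟨trivial, fun i => by
      funext j
      exact (hf x hx i j).symm⟩⟩, hinj⟩

end DVariety

/-! ### Linear `D`-varieties -/

section Linear

variable {U : Type u} [Field U] {m : ℕ} {δ : Fin m → Derivation ℤ U U} {K : Subfield U}

/-- If `DX = B X` and `DY = - Y B`, then the entries of `XY - 1` generate a `D`-stable ideal. -/
theorem derivation_matrix_mul_sub_one {R : Type*} [CommRing R] {N : ℕ} (D : Derivation ℤ R R)
    (X Y B : Matrix (Fin N) (Fin N) R) (hX : ∀ p q, D (X p q) = (B * X) p q)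
    (hY : ∀ p q, D (Y p q) = -(Y * B) p q) (p q : Fin N) :
    D ((X * Y - 1) p q) = (B * (X * Y - 1) - (X * Y - 1) * B) p q := by
  have h1 : D ((1 : Matrix (Fin N) (Fin N) R) p q) = 0 := by
    rw [Matrix.one_apply]
    split_ifs <;> simp
  have h2 : D ((X * Y) p q) = (B * X * Y - X * (Y * B)) p q := by
    rw [Matrix.sub_apply, Matrix.mul_apply, Matrix.mul_apply, Matrix.mul_apply, map_sum,
      ← Finset.sum_sub_distrib]
    refine Finset.sum_congr rfl fun r _ => ?_
    rw [Derivation.leibniz, smul_eq_mul, smul_eq_mul, hX, hY]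
    ring
  have h3 : B * X * Y - X * (Y * B) = B * (X * Y - 1) - (X * Y - 1) * B := by
    simp only [mul_sub, sub_mul, mul_one, one_mul, Matrix.mul_assoc]
    abel
  rw [← h3, ← h2, Matrix.sub_apply, map_sub, h1, sub_zero]

/-- A linear system `δᵢ x = Bᵢ x` has a fundamental matrix `X` in `U`; the statement is about its
inverse `Y`, which satisfies `δᵢ Y = - Y Bᵢ`. -/
theorem IsExistentiallyClosed.exists_fundamentalMatrix [CharZero U] (hec : IsExistentiallyClosed δ)
    {N : ℕ} (B : Fin m → Matrix (Fin N) (Fin N) U) :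
    ∃ X Y : Matrix (Fin N) (Fin N) U, X * Y = 1 ∧ ∀ i p q, δ i (Y p q) = -(Y * B i) p q := by
  classical
  let R := MvPolynomial ((Fin N × Fin N) ⊕ (Fin N × Fin N)) U
  let MX : Matrix (Fin N) (Fin N) R := Matrix.of fun p q => X (Sum.inl (p, q))
  let MY : Matrix (Fin N) (Fin N) R := Matrix.of fun p q => X (Sum.inr (p, q))
  let BC : Fin m → Matrix (Fin N) (Fin N) R := fun i => (B i).map C
  let s : Fin m → (Fin N × Fin N) ⊕ (Fin N × Fin N) → R := fun i =>
    Sum.elim (fun p => (BC i * MX) p.1 p.2) fun p => -(MY * BC i) p.1 p.2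
  let E : Matrix (Fin N) (Fin N) R := MX * MY - 1
  let S : Set R := Set.range fun p : Fin N × Fin N => E p.1 p.2
  have hE : ∀ p q, E p q ∈ Ideal.span S := fun p q => Ideal.subset_span ⟨(p, q), rfl⟩
  have hDE : ∀ i p q, polyDerivation (δ i) (s i) (E p q) = (BC i * E - E * BC i) p q :=
    fun i => derivation_matrix_mul_sub_one _ MX MY (BC i)
      (fun p q => polyDerivation_X _ _ _) fun p q => polyDerivation_X _ _ _
  obtain ⟨x, hx, hx'⟩ := hec.exists_dPoint s (Ideal.span S) (fun h => by
      -- The ideal is proper because the pair of identity matrices is a zero.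
      let y : (Fin N × Fin N) ⊕ (Fin N × Fin N) → U :=
        Sum.elim (fun p => (1 : Matrix (Fin N) (Fin N) U) p.1 p.2)
          fun p => (1 : Matrix (Fin N) (Fin N) U) p.1 p.2
      have hle : Ideal.span S ≤ RingHom.ker (eval y) := by
        rw [Ideal.span_le]
        rintro _ ⟨⟨p, q⟩, rfl⟩
        have h1 : eval y ((MX * MY) p q) =
            ((1 : Matrix (Fin N) (Fin N) U) * (1 : Matrix (Fin N) (Fin N) U)) p q := by
          rw [Matrix.mul_apply, Matrix.mul_apply, map_sum]
          exact Finset.sum_congr rfl fun r _ => by simp [MX, MY, y]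
        change eval y ((MX * MY) p q - (1 : Matrix (Fin N) (Fin N) R) p q) = 0
        rw [map_sub, h1, mul_one, Matrix.one_apply, Matrix.one_apply]
        split_ifs <;> simp
      have h1 : (1 : R) ∈ RingHom.ker (eval y) := hle (h ▸ Submodule.mem_top)
      rw [RingHom.mem_ker, map_one] at h1
      exact one_ne_zero h1)
    (fun i Q hQ => derivation_mem_span _ (by
      rintro _ ⟨⟨p, q⟩, rfl⟩
      rw [hDE, Matrix.sub_apply, Matrix.mul_apply, Matrix.mul_apply]
      exact Ideal.sub_mem _
        (Ideal.sum_mem _ fun r _ => Ideal.mul_mem_left _ _ (hE _ _))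
        (Ideal.sum_mem _ fun r _ => Ideal.mul_mem_right _ _ (hE _ _))) hQ)
  refine ⟨Matrix.of fun p q => x (Sum.inl (p, q)), Matrix.of fun p q => x (Sum.inr (p, q)), ?_, ?_⟩
  · ext p q
    have h := hx _ (hE p q)
    change eval x ((MX * MY - 1) p q) = 0 at h
    rw [Matrix.sub_apply, map_sub, sub_eq_zero, Matrix.mul_apply, map_sum] at h
    rw [Matrix.mul_apply]
    refine Eq.trans (Finset.sum_congr rfl fun r _ => ?_) (h.trans ?_)
    · simp [MX, MY]
    · rw [Matrix.one_apply, Matrix.one_apply]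
      split_ifs <;> simp
  · intro i p q
    rw [Matrix.of_apply, hx' i]
    simp only [s, Sum.elim_inr, map_neg, Matrix.mul_apply, map_sum, map_mul]
    congr 1
    exact Finset.sum_congr rfl fun r _ => by simp [MY, BC]

/-- An irreducible `D`-variety with a linear section is isotrivial: the inverse of a fundamental
matrix maps solutions to constants. -/
theorem DVariety.isIsotrivial_of_linear [CharZero U] (hec : IsExistentiallyClosed δ)
    (hK : IsDiffSubfield δ K) (V : DVariety δ K) (hirr : IsIrreducibleOver K V.carrier)
    (B : Fin m → Matrix (Fin V.n) (Fin V.n) U) (hBK : ∀ i p q, B i p q ∈ K)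
    (hB : ∀ i, ∀ x ∈ V.carrier, V.sec i x = (B i).mulVec x) : V.IsIsotrivial := by
  obtain ⟨X₁, Y, hXY, hY⟩ := hec.exists_fundamentalMatrix B
  let a : Fin (V.n * V.n) → U := fun t => Y (finProdFinEquiv.symm t).1 (finProdFinEquiv.symm t).2
  have hYa : ∀ p q, Y p q ∈ adjoin K a := fun p q => by
    have := mem_adjoin K a (finProdFinEquiv (p, q))
    simpa only [a, Equiv.symm_apply_apply] using this
  have hF : IsDiffSubfield δ (adjoin K a) := isDiffSubfield_adjoin hK a fun i t => by
    rw [hY, Matrix.mul_apply]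
    exact Subfield.neg_mem _ (Subfield.sum_mem _ fun r _ =>
      Subfield.mul_mem _ (hYa _ _) (le_adjoin K a (hBK _ _ _)))
  let f : Fin V.n → MvPolynomial (Fin V.n) (adjoin K a) := fun p =>
    ∑ q, C ⟨Y p q, hYa p q⟩ * X q
  have hf : ∀ x p, aeval x (f p) = Y.mulVec x p := fun x p => by
    simp only [f, map_sum, map_mul, aeval_C, aeval_X, Matrix.mulVec, dotProduct]
    rfl
  refine V.isIsotrivial_of_polyMap hirr _ hF (le_adjoin K a) f (fun x hx i p => ?_) ?_
  · have hx' : ∀ q, δ i (x q) = (B i).mulVec x q := fun q => by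
      rw [← hB i x hx.1, hx.2 i]
    rw [hf, Matrix.mulVec, dotProduct, map_sum]
    have h1 : ∀ q, δ i (Y p q * x q) = Y p q * (B i).mulVec x q - (Y * B i) p q * x q :=
      fun q => by
        rw [Derivation.leibniz, smul_eq_mul, smul_eq_mul, hx', hY]
        ring
    simp only [h1, Finset.sum_sub_distrib]
    have h2 := congrFun (Matrix.mulVec_mulVec x Y (B i)) p
    exact sub_eq_zero.2 h2
  · intro x _ y _ hxy
    have h : Y.mulVec x = Y.mulVec y := by
      funext p
      rw [← hf, ← hf]
      exact congrFun hxy p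
    have h' := congrArg X₁.mulVec h
    rwa [Matrix.mulVec_mulVec, Matrix.mulVec_mulVec, hXY, Matrix.one_mulVec,
      Matrix.one_mulVec] at h'

/-- The Zariski closure of the image of a `D`-variety over constants under a polynomial map `f` on
which the section acts linearly, with the linear section. -/
noncomputable def DVariety.linearImage (V : DVariety δ K) (hK : K ≤ constants δ) {N : ℕ}
    (f : Fin N → MvPolynomial (Fin V.n) K) (B : Fin m → Matrix (Fin N) (Fin N) K)
    (hB : ∀ i t, ∀ x ∈ V.carrier, prolongEval (δ i) (f t) x (V.sec i x) =
      ∑ t', (B i t t' : U) * aeval x (f t')) : DVariety δ K where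
  n := N
  carrier := zeroLocus U ((vanishingIdeal K V.carrier).comap (bind₁ f))
  isClosed := ⟨_, rfl⟩
  sec i y t := ∑ t', (B i t t' : U) * y t'
  regular i := ⟨fun t => ∑ t', C (B i t t') * X t', fun y _ => by
    funext t
    simp only [polyMap, map_sum, map_mul, aeval_C, aeval_X]
    rfl⟩
  sec_mem i y hy Q hQ := by
    have hd : ∀ c ∈ K, δ i c = 0 := fun c hc => hK hc i
    have hQ' : bind₁ f Q ∈ vanishingIdeal K V.carrier := fun x hx => by
      rw [aeval_bind₁]
      exact hQ _ fun R hR => by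
        rw [← aeval_bind₁]
        exact hR x hx
    refine ⟨hQ y hy, ?_⟩
    let Q' : MvPolynomial (Fin N) K := ∑ t, pderiv t Q * ∑ t', C (B i t t') * X t'
    have hev : ∀ z : Fin N → U, aeval z Q' =
        prolongEval (δ i) Q z (fun t => ∑ t', (B i t t' : U) * z t') := fun z => by
      rw [prolongEval_eq_sum hd]
      simp only [Q', map_sum, map_mul, aeval_C, aeval_X]
      rfl
    rw [← hev]
    refine hy Q' fun x hx => ?_
    rw [aeval_bind₁, hev]
    simp only [← hB i _ x hx]
    rw [← prolongEval_bind₁]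
    exact (V.sec_mem i x hx _ hQ').2

theorem DVariety.polyMap_mem_linearImage (V : DVariety δ K) (hK : K ≤ constants δ) {N : ℕ}
    (f : Fin N → MvPolynomial (Fin V.n) K) (B : Fin m → Matrix (Fin N) (Fin N) K)
    (hB : ∀ i t, ∀ x ∈ V.carrier, prolongEval (δ i) (f t) x (V.sec i x) =
      ∑ t', (B i t t' : U) * aeval x (f t')) (x : Fin V.n → U) (hx : x ∈ V.carrier) :
    polyMap f x ∈ (V.linearImage hK f B hB).carrier :=
  fun Q hQ => (aeval_bind₁ x f Q).symm.trans (hQ x hx)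

theorem DVariety.isIrreducibleOver_linearImage [IsAlgClosed U] (V : DVariety δ K)
    (hK : K ≤ constants δ) {N : ℕ}
    (f : Fin N → MvPolynomial (Fin V.n) K) (B : Fin m → Matrix (Fin N) (Fin N) K)
    (hB : ∀ i t, ∀ x ∈ V.carrier, prolongEval (δ i) (f t) x (V.sec i x) =
      ∑ t', (B i t t' : U) * aeval x (f t')) (hV : IsIrreducibleOver K V.carrier) :
    IsIrreducibleOver K (V.linearImage hK f B hB).carrier := by
  have : (vanishingIdeal K V.carrier).IsPrime := hV
  have h1 : ((vanishingIdeal K V.carrier).comap (bind₁ f)).IsPrime := Ideal.IsPrime.comap _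
  change (vanishingIdeal K (zeroLocus U ((vanishingIdeal K V.carrier).comap (bind₁ f)))).IsPrime
  rwa [IsPrime.vanishingIdeal_zeroLocus]

end Linear

/-! ### Subvarieties of commutative `D`-groups over constants -/

section Main

variable {U : Type u} [Field U] {m : ℕ} {δ : Fin m → Derivation ℤ U U} {k : Subfield U}

/-- The logarithmic derivatives of a commutative `D`-group over constants, collected into a single
homomorphism to a vector space. -/
theorem DGroup.exists_logDerivative_fin [CharZero U] [IsAlgClosed U] (hk : k ≤ constants δ)
    (G : DGroup δ k) (hcomm : G.IsCommutative) :
    ∃ (N : ℕ) (f : Fin N → MvPolynomial (Fin G.n) k) (B : Fin m → Matrix (Fin N) (Fin N) k),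
      (∀ t, ∀ a b : (G.toPolyGroup hcomm).carrier,
        aeval (a * b).1 (f t) = aeval a.1 (f t) + aeval b.1 (f t)) ∧
      (∀ i t, ∀ a ∈ G.carrier, prolongEval (δ i) (f t) a (G.sec i a) =
        ∑ t', (B i t t' : U) * aeval a (f t')) ∧
      ∀ a ∈ G.carrier, (∀ t, aeval a (f t) = 0) → ∀ i, G.sec i a = 0 := by
  classical
  obtain ⟨L, A, h1, h2, h3⟩ := G.exists_logDerivative hk hcomm
  let e : Fin m × Fin G.n ≃ Fin (m * G.n) := finProdFinEquiv
  refine ⟨m * G.n, fun t => L (e.symm t).1 (e.symm t).2,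
    fun i => Matrix.of fun t t' => if (e.symm t').1 = i
      then A (e.symm t).1 (e.symm t).2 (e.symm t').2 else 0, fun t => h1 _ _, ?_, ?_⟩
  · intro i t a ha
    rw [h2 i _ _ a ha, ← e.sum_comp, Fintype.sum_prod_type, Finset.sum_eq_single i]
    · simp
    · intro i' _ hi'
      simp [hi']
    · simp
  · intro a ha h i
    refine h3 i a ha fun r => ?_
    simpa using h (e (i, r))

/-- The fibres of the logarithmic derivative on a `D`-subvariety are isotrivial: division by a
`D`-point of the fibre maps its `D`-points to constants. -/
theorem DGroup.isIsotrivial_fibre [CharZero U] [IsAlgClosed U] (hec : IsExistentiallyClosed δ)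
    (hk : k ≤ constants δ) (G : DGroup δ k) (hcomm : G.IsCommutative) {N : ℕ}
    (f : Fin N → MvPolynomial (Fin G.n) k)
    (hadd : ∀ t, ∀ a b : (G.toPolyGroup hcomm).carrier,
      aeval (a * b).1 (f t) = aeval a.1 (f t) + aeval b.1 (f t))
    (hzero : ∀ a ∈ G.carrier, (∀ t, aeval a (f t) = 0) → ∀ i, G.sec i a = 0)
    {Z : Set (Fin G.n → U)} (hZ : G.toDVariety.IsDSubvariety k Z) {L : Subfield U}
    (hL : IsDiffSubfield δ L) {W : Set (Fin G.n → U)}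
    (hW : (G.toDVariety.sub Z hZ).IsDSubvariety L W) (hirr : IsIrreducibleOver L W)
    {c : Fin N → U} (hc : ∀ x ∈ W, polyMap f x = c) :
    ((G.toDVariety.sub Z hZ).sub W hW).IsIsotrivial := by
  let H := G.toPolyGroup hcomm
  have hWG : ∀ x ∈ W, x ∈ G.carrier := fun x hx => hZ.subset (hW.subset hx)
  obtain ⟨x₀, hx₀, hx₀'⟩ :=
    ((G.toDVariety.sub Z hZ).sub W hW).dPoints_nonempty hec hL hirr.nonempty
  change x₀ ∈ W at hx₀
  change ∀ i, G.sec i x₀ = fun j => δ i (x₀ j) at hx₀'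
  let g₀ : H.carrier := ⟨x₀, hWG x₀ hx₀⟩
  have hkF : k ≤ adjoin L x₀ := hW.le.trans (le_adjoin L x₀)
  have hF : IsDiffSubfield δ (adjoin L x₀) := isDiffSubfield_adjoin hL x₀ fun i j => by
    obtain ⟨S, hS⟩ := G.regular i
    have h1 : δ i (x₀ j) = aeval x₀ (S j) := by
      rw [← congrFun (hx₀' i) j, hS x₀ (hWG x₀ hx₀)]
      rfl
    rw [h1]
    exact aeval_mem_adjoin hkF x₀ (mem_adjoin L x₀) _
  -- The map `x ↦ x x₀⁻¹`, with coefficients in `L(x₀)`.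
  let b : Fin G.n → adjoin L x₀ := fun l =>
    ⟨aeval x₀ (G.invPoly l), aeval_mem_adjoin hkF x₀ (mem_adjoin L x₀) _⟩
  obtain ⟨F, hFx⟩ : ∃ F : Fin G.n → MvPolynomial (Fin G.n) (adjoin L x₀),
      ∀ x (hx : x ∈ G.carrier) j, aeval x (F j) = ((⟨x, hx⟩ : H.carrier) / g₀).1 j := by
    refine ⟨fun j => bind₁ (Sum.elim X fun l => C (b l))
      (map (Subfield.inclusion hkF) (G.mulPoly j)), ?_⟩
    intro x hx j
    rw [div_eq_mul_inv, PolyGroup.coe_mul, aeval_bind₁, aeval_def, eval₂_map]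
    change _ = eval _ (map (algebraMap k U) (G.mulPoly j))
    rw [eval_map]
    congr 1
    funext l
    rcases l with l | l
    · simp
    · rw [Sum.elim_inr, Sum.elim_inr, aeval_C, PolyGroup.coe_inv]
      exact aeval_eq_eval_map _ _
  have hinj : ∀ x ∈ W, ∀ y ∈ W, polyMap F x = polyMap F y → x = y := by
    intro x hx y hy hxy
    let gx : H.carrier := ⟨x, hWG x hx⟩
    let gy : H.carrier := ⟨y, hWG y hy⟩
    have h1 : gx / g₀ = gy / g₀ := Subtype.ext <| funext fun j =>
      (hFx x (hWG x hx) j).symm.trans ((congrFun hxy j).trans (hFx y (hWG y hy) j))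
    have h2 : gx = gy := div_left_inj.1 h1
    exact Subtype.ext_iff.1 h2
  refine DVariety.isIsotrivial_of_polyMap _ hirr _ hF (le_adjoin L x₀) F
    (fun x hx i j => ?_) hinj
  · have hxW : x ∈ W := hx.1
    have hx' : ∀ i, G.sec i x = fun j => δ i (x j) := hx.2
    let g : H.carrier := ⟨x, hWG x hxW⟩
    have hlog : ∀ t, aeval (g / g₀).1 (f t) = 0 := fun t => by
      have h1 := hadd t (g / g₀) g₀
      rw [div_mul_cancel] at h1
      have h2 : aeval g.1 (f t) = aeval g₀.1 (f t) :=
        congrFun ((hc x hxW).trans (hc x₀ hx₀).symm) t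
      rw [h2] at h1
      linear_combination -h1
    have h3 := hzero _ (g / g₀).2 hlog i
    rw [G.sec_div_eq hk hcomm i g g₀ (hx' i) (hx₀' i)] at h3
    exact (congrArg (δ i) (hFx x (hWG x hxW) j)).trans (congrFun h3 j)

/-- The tower `X → Y → 0` of `D`-varieties over `k`. -/
def towerOfMorphism [Infinite U] (X Y : DVariety δ k) : ℕ → DVariety δ k
  | 0 => DVariety.affineSpace δ k 0
  | 1 => Y
  | _ + 2 => X

end Main

end DGeom

theorem mainTheorem6 {U : Type u} [Field U] [CharZero U] {m : ℕ} (hm : 0 < m)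
    (δ : Fin m → Derivation ℤ U U)
    (hec : DGeom.IsExistentiallyClosed δ) (hsat : DGeom.IsSaturated δ)
    (k : Subfield U) (hk : k ≤ DGeom.constants δ) (hsmall : #k < #U)
    (G : DGeom.DGroup δ k) (hconn : G.IsConnected) (hcomm : G.IsCommutative)
    (Z : Set (Fin G.n → U)) (hZ : G.toDVariety.IsDSubvariety k Z)
    (hirr : DGeom.IsIrreducibleOver k Z) :
    (G.toDVariety.sub Z hZ).IsCompoundIsotrivial 2 := by
  open DGeom in
  have : IsAlgClosed U := hec.isAlgClosed
  obtain ⟨N, f, B, hadd, hB, hzero⟩ := G.exists_logDerivative_fin hk hcomm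
  have hkdiff : IsDiffSubfield δ k := isDiffSubfield_of_le_constants hk
  let V₂ := G.toDVariety.sub Z hZ
  let V₁ := V₂.linearImage hk f B fun i t x hx => hB i t x (hZ.subset hx)
  let V₀ := DVariety.affineSpace δ k 0
  have hV₂ : IsIrreducibleOver k V₂.carrier := hirr
  have hmaps : ∀ x ∈ V₂.carrier, polyMap f x ∈ V₁.carrier :=
    V₂.polyMap_mem_linearImage hk f B _
  have hV₁ : IsIrreducibleOver k V₁.carrier := V₂.isIrreducibleOver_linearImage hk f B _ hV₂
  have hV₀ : V₀.carrier = {0} := Set.eq_singleton_iff_unique_mem.2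
    ⟨trivial, fun x _ => funext fun j => j.elim0⟩
  refine ⟨towerOfMorphism V₂ V₁, rfl, hV₀, fun i hi => ?_, fun i hi => ?_⟩
  · obtain rfl | rfl | rfl : i = 0 ∨ i = 1 ∨ i = 2 := by omega
    · change IsIrreducibleOver k V₀.carrier
      rw [hV₀, IsIrreducibleOver]
      infer_instance
    · exact hV₁
    · exact hV₂
  obtain rfl | rfl : i = 0 ∨ i = 1 := by omega
  · -- The fibre of `V₁ → 0` is `V₁`, a linear `D`-variety.
    change ∃ f : (Fin V₁.n → U) → (Fin V₀.n → U), DVariety.IsDMorphism k V₁ V₀ f ∧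
      IsDominant V₁.carrier V₀.carrier f ∧ ∀ a ∈ V₀.dPoints, IsGenericPoint k V₀.carrier a →
        ∃ h : V₁.IsDSubvariety (adjoin k a) {x | x ∈ V₁.carrier ∧ f x = a},
          (V₁.sub _ h).IsIsotrivial
    let P : Fin V₀.n → MvPolynomial (Fin V₁.n) k := fun j => j.elim0
    have hmaps₀ : ∀ x ∈ V₁.carrier, polyMap P x ∈ V₀.carrier := fun _ _ => trivial
    have hsec₀ : ∀ i, ∀ x ∈ V₁.carrier, V₀.sec i (polyMap P x) =
        fun j => prolongEval (δ i) (P j) x (V₁.sec i x) := fun _ _ _ => funext fun j => j.elim0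
    have hdom₀ : IsDominant V₁.carrier V₀.carrier (polyMap P) := fun Q hQ y _ => by
      obtain ⟨x, hx⟩ := hV₁.nonempty
      have hy : y = polyMap P x := funext fun j => j.elim0
      rw [hy]
      exact hQ x hx
    refine ⟨polyMap P, V₁.isDMorphism_polyMap V₀ P hmaps₀ hsec₀, hdom₀, fun a ha hgen => ?_⟩
    obtain ⟨h, hirr'⟩ := V₁.isDSubvariety_fibre V₀ hV₁ P hmaps₀ hsec₀ hdom₀ ha hgen
    exact ⟨h, DVariety.isIsotrivial_of_linear hec
      (isDiffSubfield_adjoin hkdiff a fun _ j => j.elim0) (V₁.sub _ h) hirr'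
      (fun i => (B i).map fun c => (c : U)) (fun i p q => le_adjoin k a (B i p q).2)
      fun i x _ => rfl⟩
  · -- The fibres of `V₂ → V₁` lie in cosets of the kernel of the logarithmic derivative.
    change ∃ f : (Fin V₂.n → U) → (Fin V₁.n → U), DVariety.IsDMorphism k V₂ V₁ f ∧
      IsDominant V₂.carrier V₁.carrier f ∧ ∀ a ∈ V₁.dPoints, IsGenericPoint k V₁.carrier a →
        ∃ h : V₂.IsDSubvariety (adjoin k a) {x | x ∈ V₂.carrier ∧ f x = a},
          (V₂.sub _ h).IsIsotrivial
    have hsec : ∀ i, ∀ x ∈ V₂.carrier, V₁.sec i (polyMap f x) =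
        fun j => prolongEval (δ i) (f j) x (V₂.sec i x) :=
      fun i x hx => funext fun t => (hB i t x (hZ.subset hx)).symm
    have hdom : IsDominant V₂.carrier V₁.carrier (polyMap f) :=
      isDominant_zeroLocus_comap V₂.isClosed f
    refine ⟨polyMap f, V₂.isDMorphism_polyMap V₁ f hmaps hsec, hdom, fun a ha hgen => ?_⟩
    obtain ⟨h, hirr'⟩ := V₂.isDSubvariety_fibre V₁ hV₂ f hmaps hsec hdom ha hgen
    have hL : IsDiffSubfield δ (adjoin k a) := isDiffSubfield_adjoin hkdiff a fun i t => by
      rw [← congrFun (ha.2 i) t]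
      change ∑ t', (B i t t' : U) * a t' ∈ adjoin k a
      exact Subfield.sum_mem _ fun t' _ =>
        Subfield.mul_mem _ (le_adjoin k a (B i t t').2) (mem_adjoin k a t')
    exact ⟨h, G.isIsotrivial_fibre hec hk hcomm f hadd hzero hZ hL h hirr' fun x hx => hx.2⟩
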